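/- Let $n\ge 1$, let $\alpha=(\alpha_1,\dots,\alpha_m)$ be a partition of $n$ with $m$ parts, let $g\ge 0$, and let $\mathcal K_\alpha\subset\mathfrak S_n$ be the class of permutations of $[n]=\{1,\dots,n\}$ of cycle type $\alpha$. A factorization of a permutation is called transitive if its factors generate a group acting transitively on $[n]$. Fix a pivot $p\in[n]$ (for instance $p=n$) and let $a_g(\alpha)$ be the number of transitive ordered factorizations $\sigma=\tau_1\cdots\tau_r$ of a permutation $\sigma\in\mathcal K_\alpha$ into $r=n+m-2+2g$ star transpositions $(i\ p)$, $i\ne p$. For $k\ge 0$ let $b_k(\alpha)$ be the number of transitive factorizations $\rho=\tau_1\cdots\tau_s\,c$ of a permutation $\rho\in\mathcal K_\alpha$ into $s=m-1+2k$ arbitrary transpositions and a single $n$-cycle $c$ (for $n=1$ the identity is the $1$-cycle); equivalently $b_k(\alpha)=\alpha_1\cdots\alpha_m H^k_{(n),\alpha}$, with $H^k_{(n),\alpha}$ the genus $k$ double Hurwitz number. Then, for every choice of $\sigma,\rho\in\mathcal K_\alpha$ (so that, in particular, $a_g(\alpha)$ depends only on $\alpha$), $$a_g(\alpha)=\frac{1}{n!}\sum_{h=0}^g\frac{b_{g-h}(\alpha)}{n^{m-2+2g-2h}}\binom{n+m-2+2g}{n-1+2h}\sum_{j=0}^{n-1}\binom{n-1}{j}(-1)^j\left(\tfrac12(n-1)-j\right)^{n-1+2h},$$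 where $0^0=1$. -/

import Mathlib

/-- The number `m` of cycles of `σ` (fixed points included), that is, the number of parts of its
cycle-type partition. -/
def numCycles {n : ℕ} (σ : Equiv.Perm (Fin n)) : ℕ :=
  σ.partition.parts.card

/-- `σ` lies in the conjugacy class indexed by the partition `α` of `n`. -/
def InClass {n : ℕ} (α : n.Partition) (σ : Equiv.Perm (Fin n)) : Prop :=
  σ.partition.parts = α.parts

/-- A star transposition with pivot `p`: a transposition `(i p)` with `i ≠ p`. -/
def IsStarTransposition {n : ℕ} (p : Fin n) (τ : Equiv.Perm (Fin n)) : Prop :=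
  ∃ i : Fin n, i ≠ p ∧ τ = Equiv.swap i p

/-- `c` is an `n`-cycle, that is, its cycle type is the partition `(n)` of `n`.
For `n = 1` this is the identity. -/
def IsFullCycle {n : ℕ} (c : Equiv.Perm (Fin n)) : Prop :=
  c.partition.parts = {n}

/-- The group generated by the set `S` of permutations acts transitively. -/
def GeneratesTransitive {n : ℕ} (S : Set (Equiv.Perm (Fin n))) : Prop :=
  MulAction.IsPretransitive (Subgroup.closure S) (Fin n)

/-- The transitive ordered factorizations `σ = τ₁ ⋯ τᵣ` of `σ` into `r` star transpositions with
pivot `p`. -/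
def starFactorizations {n : ℕ} (p : Fin n) (r : ℕ) (σ : Equiv.Perm (Fin n)) :
    Set (Fin r → Equiv.Perm (Fin n)) :=
  {τ | (∀ k, IsStarTransposition p (τ k)) ∧ (List.ofFn τ).prod = σ ∧
    GeneratesTransitive (Set.range τ)}

/-- The transitive factorizations `σ = τ₁ ⋯ τᵣ c` of `σ` into `r` transpositions and an
`n`-cycle. -/
def cycleFactorizations {n : ℕ} (r : ℕ) (σ : Equiv.Perm (Fin n)) :
    Set ((Fin r → Equiv.Perm (Fin n)) × Equiv.Perm (Fin n)) :=
  {x | (∀ k, (x.1 k).IsSwap) ∧ IsFullCycle x.2 ∧ (List.ofFn x.1).prod * x.2 = σ ∧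
    GeneratesTransitive (insert x.2 (Set.range x.1))}

/-- The genus `g` star factorization number of `σ`, with pivot `p`: the number of transitive
factorizations of `σ` into `n + m - 2 + 2g` star transpositions. (The existence of `p` forces
`n ≥ 1` and `m ≥ 1`, so the subtraction does not truncate.) -/
noncomputable def starFactorizationNumber {n : ℕ} (p : Fin n) (g : ℕ)
    (σ : Equiv.Perm (Fin n)) : ℕ :=
  (starFactorizations p (n + numCycles σ - 2 + 2 * g) σ).ncard

/-- The number of transitive factorizations of `σ` into `m - 1 + 2g` transpositions and a single
`n`-cycle: the genus `g` double Hurwitz number for `(n)` and the cycle type of `σ`, multiplied by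
the lengths of the cycles of `σ`. (For `n ≥ 1` one has `m ≥ 1`.) -/
noncomputable def cycleFactorizationNumber {n : ℕ} (g : ℕ) (σ : Equiv.Perm (Fin n)) : ℕ :=
  (cycleFactorizations (numCycles σ - 1 + 2 * g) σ).ncard

/-!
Both sides have explicit generating functions. Write `f l = 2 sinh (l X / 2)` and let `l` run over
the cycle lengths of a permutation `σ` of `n` points, fixed points included.

* The transitive star factorizations of `σ` have the exponential generating function
  `f 1 ^ (n - 2) * ∏ f l / n!` in the length (`card_starWords_div_factorial`).
* The factorizations of `σ` into `s` transpositions and a full cycle, weighted by `(X / n) ^ s / s!`,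
  have the generating function `∏ f l / (n * f 1)` (`card_swapWords_div`).

Hence the first series is `f 1 ^ (n - 1) / (n - 1)!` times the second (`starSolution_eq`), and the
theorem is the comparison of coefficients: those of `f 1 ^ (n - 1)` are the alternating sums over
`j`, by the binomial theorem. The product has only the terms in the theorem because the two factors
have orders at least `n - 1` and `m - 1` and the first one is even or odd
(`coeff_mul_eq_sum_range`).

Each explicit generating function is verified by showing that it satisfies the differential
equation that corresponds to removing the first factor of a factorization. For star factorizations
the words are refined by the set `S` of indices that occur in them: a factorization is transitive
if and only if every index occurs (`generatesTransitive_iff`), and if the first index `i` does not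
occur again, what remains is a word on `S \ {i}`. Multiplication by a transposition joins two cycles
or cuts one. With the weight `F σ = ∏ f l` and `c l = coth (l X / 2)`, the addition formulas of
hyperbolic functions give, for every point `a`,
`∑ b ≠ a, F ((a b) σ) = F σ * (∑ b, (c (l a) + c (l b)) / 2 - c 1)`,
where `l b` is the length of the cycle through `b` (`two_mul_sum_cycleProd_swap_mul`). As
`∑ b, c (l b) / 2` is the logarithmic derivative of `F σ`, this sum over points, which is blind to
the distinction of joins and cuts, settles both differential equations. The computations with
quotients take place in the field of fractions of `ℚ⟦X⟧`.
-/

open Equiv Equiv.Perm PowerSeries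

/-! ### Cycles of a permutation and multiplication by a transposition -/

section Cycles
variable {α : Type*}

lemma pow_injOn_minimalPeriod (σ : Perm α) (x : α) :
    Set.InjOn (fun j : ℕ => (σ ^ j) x) (Set.Iio (Function.minimalPeriod σ x)) := by
  intro i hi j hj h
  simp only [← iterate_eq_pow] at h
  exact (Function.iterate_injOn_Iio_minimalPeriod hi hj h)

variable [DecidableEq α]

lemma swap_mul_apply_of_not_sameCycle {σ : Perm α} {a b x : α} (ha : ¬ σ.SameCycle a x)
    (hb : ¬ σ.SameCycle b x) : (swap a b * σ) x = σ x := by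
  rw [Perm.mul_apply, swap_apply_of_ne_of_ne]
  · rintro rfl
    exact ha (sameCycle_apply_left.2 (SameCycle.refl _ _))
  · rintro rfl
    exact hb (sameCycle_apply_left.2 (SameCycle.refl _ _))

lemma swap_mul_pow_apply_of_not_sameCycle {σ : Perm α} {a b x : α} (ha : ¬ σ.SameCycle a x)
    (hb : ¬ σ.SameCycle b x) (j : ℕ) : ((swap a b * σ) ^ j) x = (σ ^ j) x := by
  induction j with
  | zero => rfl
  | succ j ih =>
    rw [pow_succ', Perm.mul_apply, ih, swap_mul_apply_of_not_sameCycle, pow_succ',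
      Perm.mul_apply] <;> rwa [sameCycle_pow_right]

variable [Fintype α]

/-- The set of points of the cycle of `σ` through `x`; it is `{x}` if `x` is a fixed point. -/
def cycleClass (σ : Perm α) (x : α) : Finset α := Finset.univ.filter (σ.SameCycle x)

/-- The cycles of `σ`, as sets of points. Fixed points count as cycles, unlike in
`Equiv.Perm.cycleFactorsFinset`. -/
def cycleClasses (σ : Perm α) : Finset (Finset α) := Finset.univ.image (cycleClass σ)

lemma mem_cycleClass {σ : Perm α} {x y : α} : y ∈ cycleClass σ x ↔ σ.SameCycle x y := by
  simp [cycleClass]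

lemma self_mem_cycleClass (σ : Perm α) (x : α) : x ∈ cycleClass σ x :=
  mem_cycleClass.2 (SameCycle.refl σ x)

lemma cycleClass_eq_iff {σ : Perm α} {x y : α} :
    cycleClass σ x = cycleClass σ y ↔ σ.SameCycle x y := by
  constructor
  · intro h
    have := self_mem_cycleClass σ y
    rwa [← h, mem_cycleClass] at this
  · intro h
    ext z
    rw [mem_cycleClass, mem_cycleClass]
    exact ⟨fun hz => h.symm.trans hz, fun hz => h.trans hz⟩

lemma cycleClass_of_fixed {σ : Perm α} {x : α} (h : σ x = x) : cycleClass σ x = {x} := by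
  ext y
  rw [mem_cycleClass, Finset.mem_singleton]
  exact ⟨fun hxy => (hxy.eq_of_left h).symm, fun hxy => hxy ▸ SameCycle.refl σ _⟩

lemma cycleClass_eq_support_cycleOf {σ : Perm α} {x : α} (h : σ x ≠ x) :
    cycleClass σ x = (σ.cycleOf x).support := by
  ext y
  rw [mem_cycleClass, mem_support_cycleOf_iff' h]

lemma cycleClasses_eq (σ : Perm α) :
    cycleClasses σ = σ.cycleFactorsFinset.image support ∪ σ.supportᶜ.image (fun x => {x}) := by
  ext s
  simp only [cycleClasses, Finset.mem_image, Finset.mem_union, Finset.mem_univ, true_and,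
    Finset.mem_compl, mem_support, not_not]
  constructor
  · rintro ⟨x, rfl⟩
    by_cases h : σ x = x
    · exact Or.inr ⟨x, h, (cycleClass_of_fixed h).symm⟩
    · exact Or.inl ⟨σ.cycleOf x, cycleOf_mem_cycleFactorsFinset_iff.2 (mem_support.2 h),
        (cycleClass_eq_support_cycleOf h).symm⟩
  · rintro (⟨c, hc, rfl⟩ | ⟨x, hx, rfl⟩)
    · obtain ⟨x, hx⟩ := (mem_cycleFactorsFinset_iff.1 hc).1.nonempty_support
      have h1 := cycle_is_cycleOf hx hc
      have h2 : σ x ≠ x := mem_support.1 (mem_cycleFactorsFinset_support_le hc hx)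
      exact ⟨x, by rw [cycleClass_eq_support_cycleOf h2, ← h1]⟩
    · exact ⟨x, cycleClass_of_fixed hx⟩

lemma parts_partition_eq_map_card (σ : Perm α) :
    σ.partition.parts = (cycleClasses σ).val.map Finset.card := by
  have hdisj : _root_.Disjoint (σ.cycleFactorsFinset.image support)
      (σ.supportᶜ.image (fun x => ({x} : Finset α))) := by
    rw [Finset.disjoint_left]
    intro s hs hs'
    obtain ⟨c, hc, rfl⟩ := Finset.mem_image.1 hs
    obtain ⟨x, -, hx⟩ := Finset.mem_image.1 hs'
    have := (mem_cycleFactorsFinset_iff.1 hc).1.two_le_card_support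
    rw [← hx] at this
    simp at this
  have hinj : Set.InjOn support (σ.cycleFactorsFinset : Set (Perm α)) := by
    intro c hc d hd h
    by_contra hcd
    have h1 := (cycleFactorsFinset_pairwise_disjoint σ hc hd hcd).disjoint_support
    have h1 : _root_.Disjoint c.support d.support := h1
    rw [show c.support = d.support from h, disjoint_self] at h1
    exact (mem_cycleFactorsFinset_iff.1 hd).1.nonempty_support.ne_empty h1
  rw [cycleClasses_eq, ← Finset.disjUnion_eq_union _ _ hdisj, Finset.disjUnion_val,
    Multiset.map_add, Finset.image_val_of_injOn hinj,
    Finset.image_val_of_injOn (Finset.singleton_injective.injOn), parts_partition,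
    cycleType_def, Multiset.map_map, Multiset.map_map]
  congr 1
  simp only [Function.comp_def, Finset.card_singleton, Multiset.map_const', Finset.card_val,
    Finset.card_compl]

/-- The product of `φ` over the lengths of all cycles of `σ`, fixed points included. -/
def cycleProd {M : Type*} [CommMonoid M] (φ : ℕ → M) (σ : Perm α) : M :=
  (σ.partition.parts.map φ).prod

/-- The length of the cycle of `σ` through `x`; it is `1` if `x` is a fixed point. -/
def cycleLen (σ : Perm α) (x : α) : ℕ := (cycleClass σ x).card

lemma cycleProd_eq {M : Type*} [CommMonoid M] (φ : ℕ → M) (σ : Perm α) :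
    cycleProd φ σ = ∏ c ∈ cycleClasses σ, φ c.card := by
  rw [cycleProd, parts_partition_eq_map_card, Multiset.map_map]
  rfl

/-- Sums over points turn into sums over cycles, in which a cycle counts as often as it has
points. -/
lemma sum_cycleLen {M : Type*} [AddCommMonoid M] (ψ : ℕ → M) (σ : Perm α) :
    ∑ x, ψ (cycleLen σ x) = (σ.partition.parts.map (fun l => l • ψ l)).sum := by
  rw [parts_partition_eq_map_card, Multiset.map_map]
  change _ = ∑ c ∈ cycleClasses σ, c.card • ψ c.card
  rw [← Finset.sum_fiberwise_of_maps_to (g := cycleClass σ) (t := cycleClasses σ)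
    (fun x _ => Finset.mem_image_of_mem _ (Finset.mem_univ x))]
  refine Finset.sum_congr rfl fun c hc => ?_
  obtain ⟨y, -, rfl⟩ := Finset.mem_image.1 hc
  have : Finset.univ.filter (fun x => cycleClass σ x = cycleClass σ y) = cycleClass σ y := by
    ext z
    simp [cycleClass_eq_iff, mem_cycleClass, sameCycle_comm]
  rw [this, ← Finset.sum_const]
  refine Finset.sum_congr rfl fun x hx => ?_
  rw [cycleLen, cycleClass_eq_iff.2 (mem_cycleClass.1 hx).symm]

lemma cycleLen_eq_of_sameCycle {σ : Perm α} {x y : α} (h : σ.SameCycle x y) :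
    cycleLen σ x = cycleLen σ y := by
  rw [cycleLen, cycleLen, cycleClass_eq_iff.2 h]

lemma cycleLen_pos (σ : Perm α) (x : α) : 0 < cycleLen σ x :=
  Finset.card_pos.2 ⟨x, self_mem_cycleClass σ x⟩

lemma cycleClass_eq_image (σ : Perm α) (x : α) :
    cycleClass σ x =
      (Finset.range (Function.minimalPeriod σ x)).image (fun j : ℕ => (σ ^ j) x) := by
  have hpos : 0 < Function.minimalPeriod σ x :=
    Function.minimalPeriod_pos_of_mem_periodicPts
      (Function.Injective.mem_periodicPts σ.injective x)
  ext y
  simp only [mem_cycleClass, Finset.mem_image, Finset.mem_range]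
  constructor
  · intro h
    obtain ⟨i, hi⟩ := h.exists_nat_pow_eq
    refine ⟨i % Function.minimalPeriod σ x, Nat.mod_lt _ hpos, ?_⟩
    rw [← iterate_eq_pow] at hi ⊢
    rw [Function.iterate_mod_minimalPeriod_eq, hi]
  · rintro ⟨j, -, rfl⟩
    exact sameCycle_pow_right.2 (SameCycle.refl _ _)

lemma cycleLen_eq_minimalPeriod (σ : Perm α) (x : α) :
    cycleLen σ x = Function.minimalPeriod σ x := by
  rw [cycleLen, cycleClass_eq_image, Finset.card_image_of_injOn, Finset.card_range]
  simpa using pow_injOn_minimalPeriod σ x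

lemma pow_injOn_cycleLen (σ : Perm α) (x : α) :
    Set.InjOn (fun j : ℕ => (σ ^ j) x) (Set.Iio (cycleLen σ x)) := by
  rw [cycleLen_eq_minimalPeriod]; exact pow_injOn_minimalPeriod σ x

lemma eq_of_pow_apply_eq {σ : Perm α} {x : α} {i j : ℕ} (hi : i < cycleLen σ x)
    (hj : j < cycleLen σ x) (h : (σ ^ i) x = (σ ^ j) x) : i = j :=
  pow_injOn_cycleLen σ x hi hj h

lemma pow_cycleLen_apply (σ : Perm α) (x : α) : (σ ^ cycleLen σ x) x = x := by
  rw [cycleLen_eq_minimalPeriod, ← iterate_eq_pow]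
  exact Function.iterate_minimalPeriod

lemma cycleClass_eq_image_range (σ : Perm α) (x : α) :
    cycleClass σ x = (Finset.range (cycleLen σ x)).image (fun j : ℕ => (σ ^ j) x) := by
  rw [cycleLen_eq_minimalPeriod]; exact cycleClass_eq_image σ x

/-- A first return time to `x` is the length of its cycle. -/
lemma cycleLen_eq_of_first_return {σ : Perm α} {x : α} {t : ℕ} (ht : 0 < t)
    (h : (σ ^ t) x = x) (h' : ∀ j, 0 < j → j < t → (σ ^ j) x ≠ x) : cycleLen σ x = t := by
  rw [cycleLen_eq_minimalPeriod]
  have h1 : Function.minimalPeriod σ x ≤ t :=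
    Function.IsPeriodicPt.minimalPeriod_le ht (by
      rw [Function.IsPeriodicPt, iterate_eq_pow]; exact h)
  have hpos : 0 < Function.minimalPeriod σ x :=
    Function.minimalPeriod_pos_of_mem_periodicPts
      (Function.Injective.mem_periodicPts σ.injective x)
  by_contra hne
  refine h' _ hpos (lt_of_le_of_ne h1 hne) ?_
  rw [← iterate_eq_pow]
  exact Function.iterate_minimalPeriod

/-- Until it returns to `a`, the orbit of `a` is unchanged when its cycle is joined to that of `b`:
only the last step, which led back to `a`, is redirected to `b`. -/
lemma swap_mul_pow_apply {σ : Perm α} {a b : α} (hab : ¬ σ.SameCycle a b) {j : ℕ}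
    (hj : j < cycleLen σ a) : ((swap a b * σ) ^ j) a = (σ ^ j) a := by
  induction j with
  | zero => rfl
  | succ j ih =>
    rw [pow_succ', Perm.mul_apply, ih (by omega), pow_succ', Perm.mul_apply, Perm.mul_apply]
    rw [swap_apply_of_ne_of_ne]
    · intro h
      rw [← Perm.mul_apply, ← pow_succ'] at h
      exact absurd (eq_of_pow_apply_eq (j := 0) hj (cycleLen_pos σ a) h) (by omega)
    · intro h
      apply hab
      rw [← h, sameCycle_apply_right]
      exact sameCycle_pow_right.2 (SameCycle.refl _ _)

lemma sameCycle_swap_mul_of_sameCycle {σ : Perm α} {a b x : α} (hab : ¬ σ.SameCycle a b)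
    (hx : σ.SameCycle a x) : (swap a b * σ).SameCycle a x := by
  have := mem_cycleClass.2 hx
  rw [cycleClass_eq_image_range] at this
  obtain ⟨j, hj, rfl⟩ := Finset.mem_image.1 this
  rw [← swap_mul_pow_apply hab (Finset.mem_range.1 hj)]
  exact sameCycle_pow_right.2 (SameCycle.refl _ _)

lemma swap_mul_sameCycle {σ : Perm α} {a b : α} (hab : ¬ σ.SameCycle a b) :
    (swap a b * σ).SameCycle a b := by
  have hpos := cycleLen_pos σ a
  have h : ((swap a b * σ) ^ (cycleLen σ a)) a = b := by
    obtain ⟨k, hk⟩ : ∃ k, cycleLen σ a = k + 1 := ⟨_, (Nat.succ_pred_eq_of_pos hpos).symm⟩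
    have h2 := pow_cycleLen_apply σ a
    rw [hk, pow_succ', Perm.mul_apply] at h2
    rw [hk, pow_succ', Perm.mul_apply, swap_mul_pow_apply hab (by omega), Perm.mul_apply, h2,
      swap_apply_left]
  exact ⟨cycleLen σ a, by exact_mod_cast h⟩

lemma cycleClass_swap_mul_of_not_sameCycle {σ : Perm α} {a b x : α} (ha : ¬ σ.SameCycle a x)
    (hb : ¬ σ.SameCycle b x) : cycleClass (swap a b * σ) x = cycleClass σ x := by
  ext y
  rw [mem_cycleClass, mem_cycleClass]
  constructor <;> intro h <;> obtain ⟨j, hj⟩ := h.exists_nat_pow_eq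
  · rw [swap_mul_pow_apply_of_not_sameCycle ha hb] at hj
    exact hj ▸ sameCycle_pow_right.2 (SameCycle.refl _ _)
  · rw [← swap_mul_pow_apply_of_not_sameCycle ha hb] at hj
    exact hj ▸ sameCycle_pow_right.2 (SameCycle.refl _ _)

lemma cycleClass_swap_mul_left {σ : Perm α} {a b : α} (hab : ¬ σ.SameCycle a b) :
    cycleClass (swap a b * σ) a = cycleClass σ a ∪ cycleClass σ b := by
  ext y
  rw [Finset.mem_union, mem_cycleClass, mem_cycleClass, mem_cycleClass]
  constructor
  · intro h
    by_contra! hy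
    have h1 := cycleClass_swap_mul_of_not_sameCycle hy.1 hy.2
    have h2 := mem_cycleClass.2 h.symm
    rw [h1, mem_cycleClass] at h2
    exact hy.1 h2.symm
  · rintro (h | h)
    · exact sameCycle_swap_mul_of_sameCycle hab h
    · refine (swap_mul_sameCycle hab).trans ?_
      rw [swap_comm]
      exact sameCycle_swap_mul_of_sameCycle (fun h' => hab h'.symm) h

lemma cycleClasses_swap_mul {σ : Perm α} {a b : α} (hab : ¬ σ.SameCycle a b) :
    cycleClasses (swap a b * σ) = insert (cycleClass σ a ∪ cycleClass σ b)
      (((cycleClasses σ).erase (cycleClass σ a)).erase (cycleClass σ b)) := by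
  ext s
  simp only [cycleClasses, Finset.mem_image, Finset.mem_univ, true_and, Finset.mem_insert,
    Finset.mem_erase]
  constructor
  · rintro ⟨x, rfl⟩
    by_cases hx : (swap a b * σ).SameCycle a x
    · left
      rw [← cycleClass_eq_iff.2 hx, cycleClass_swap_mul_left hab]
    · right
      have h : x ∉ cycleClass σ a ∪ cycleClass σ b := by
        rwa [← cycleClass_swap_mul_left hab, mem_cycleClass]
      simp only [Finset.mem_union, mem_cycleClass, not_or] at h
      rw [cycleClass_swap_mul_of_not_sameCycle h.1 h.2]
      exact ⟨fun h' => h.2 (cycleClass_eq_iff.1 h').symm,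
        fun h' => h.1 (cycleClass_eq_iff.1 h').symm, x, rfl⟩
  · rintro (rfl | ⟨h1, h2, x, rfl⟩)
    · exact ⟨a, cycleClass_swap_mul_left hab⟩
    · exact ⟨x, cycleClass_swap_mul_of_not_sameCycle
        (fun h => h2 (cycleClass_eq_iff.2 h.symm)) (fun h => h1 (cycleClass_eq_iff.2 h.symm))⟩

lemma disjoint_cycleClass {σ : Perm α} {a b : α} (hab : ¬ σ.SameCycle a b) :
    _root_.Disjoint (cycleClass σ a) (cycleClass σ b) := by
  rw [Finset.disjoint_left]
  intro x ha hb
  exact hab ((mem_cycleClass.1 ha).trans (mem_cycleClass.1 hb).symm)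

/-- A transposition of points in different cycles joins these cycles. -/
lemma cycleProd_swap_mul_of_not_sameCycle {M : Type*} [CommMonoid M] (φ : ℕ → M) {σ : Perm α}
    {a b : α} (hab : ¬ σ.SameCycle a b) :
    cycleProd φ (swap a b * σ) * (φ (cycleLen σ a) * φ (cycleLen σ b)) =
      φ (cycleLen σ a + cycleLen σ b) * cycleProd φ σ := by
  have hne : cycleClass σ b ≠ cycleClass σ a := fun h => hab (cycleClass_eq_iff.1 h).symm
  have hb : cycleClass σ b ∈ (cycleClasses σ).erase (cycleClass σ a) :=
    Finset.mem_erase.2 ⟨hne, Finset.mem_image_of_mem _ (Finset.mem_univ b)⟩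
  have ha : cycleClass σ a ∈ cycleClasses σ := Finset.mem_image_of_mem _ (Finset.mem_univ a)
  rw [cycleProd_eq, cycleProd_eq, cycleClasses_swap_mul hab, Finset.prod_insert,
    Finset.card_union_of_disjoint (disjoint_cycleClass hab), ← Finset.mul_prod_erase _ _ ha,
    ← Finset.mul_prod_erase _ _ hb]
  · simp only [cycleLen]
    ac_rfl
  · intro h
    obtain ⟨h1, h2, h3⟩ : _ ∧ _ ∧ _ := by simpa only [Finset.mem_erase] using h
    obtain ⟨x, -, hx⟩ := Finset.mem_image.1 h3
    have h4 : a ∈ cycleClass σ x := by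
      rw [hx]; exact Finset.mem_union_left _ (self_mem_cycleClass σ a)
    exact h2 (by rw [← hx]; exact cycleClass_eq_iff.2 (mem_cycleClass.1 h4))

section Cut
variable {σ : Perm α} {a : α} {t : ℕ}

/-- The first `t` points of the orbit of `a` are unchanged when the cycle is cut at `σ ^ t a`. -/
lemma swap_mul_pow_apply_of_lt (ht' : t < cycleLen σ a) {j : ℕ} (hj : j < t) :
    ((swap a ((σ ^ t) a) * σ) ^ j) a = (σ ^ j) a := by
  induction j with
  | zero => rfl
  | succ j ih =>
    rw [pow_succ', Perm.mul_apply, ih (by omega), Perm.mul_apply, ← Perm.mul_apply σ,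
      ← pow_succ', swap_apply_of_ne_of_ne]
    · intro h
      exact absurd (eq_of_pow_apply_eq (j := 0) (by omega) (cycleLen_pos σ a) h) (by omega)
    · intro h
      exact absurd (eq_of_pow_apply_eq (by omega) ht' h) (by omega)

lemma swap_mul_pow_apply_eq_self (ht : 0 < t) (ht' : t < cycleLen σ a) :
    ((swap a ((σ ^ t) a) * σ) ^ t) a = a := by
  obtain ⟨k, rfl⟩ : ∃ k, t = k + 1 := ⟨_, (Nat.succ_pred_eq_of_pos ht).symm⟩
  rw [pow_succ' (swap a ((σ ^ (k + 1)) a) * σ), Perm.mul_apply,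
    swap_mul_pow_apply_of_lt ht' (by omega), Perm.mul_apply, ← Perm.mul_apply σ, ← pow_succ',
    swap_apply_right]

lemma cycleLen_swap_mul_left (ht : 0 < t) (ht' : t < cycleLen σ a) :
    cycleLen (swap a ((σ ^ t) a) * σ) a = t := by
  refine cycleLen_eq_of_first_return ht (swap_mul_pow_apply_eq_self ht ht') fun j hj hjt h => ?_
  rw [swap_mul_pow_apply_of_lt ht' hjt] at h
  exact absurd (eq_of_pow_apply_eq (j := 0) (by omega) (cycleLen_pos σ a) h) (by omega)

lemma cycleLen_swap_mul_right (ht : 0 < t) (ht' : t < cycleLen σ a) :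
    cycleLen (swap a ((σ ^ t) a) * σ) ((σ ^ t) a) = cycleLen σ a - t := by
  have hb : cycleLen σ ((σ ^ t) a) = cycleLen σ a :=
    (cycleLen_eq_of_sameCycle (sameCycle_pow_right.2 (SameCycle.refl _ _))).symm
  have hba : (σ ^ (cycleLen σ a - t)) ((σ ^ t) a) = a := by
    rw [← Perm.mul_apply, ← pow_add, Nat.sub_add_cancel ht'.le, pow_cycleLen_apply]
  have := cycleLen_swap_mul_left (σ := σ) (a := (σ ^ t) a) (t := cycleLen σ a - t) (by omega)
    (by omega)
  rwa [hba, swap_comm] at this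

lemma not_sameCycle_swap_mul (ht : 0 < t) (ht' : t < cycleLen σ a) :
    ¬ (swap a ((σ ^ t) a) * σ).SameCycle a ((σ ^ t) a) := by
  intro h
  have := mem_cycleClass.2 h
  rw [cycleClass_eq_image_range, cycleLen_swap_mul_left ht ht'] at this
  obtain ⟨j, hj, hj'⟩ := Finset.mem_image.1 this
  have hj := Finset.mem_range.1 hj
  simp only [swap_mul_pow_apply_of_lt ht' hj] at hj'
  exact absurd (eq_of_pow_apply_eq (by omega) ht' hj') (by omega)

/-- A transposition of points in the same cycle cuts this cycle. This is the joining of cycles read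
backwards, as the same transposition joins the two pieces again. -/
lemma cycleProd_swap_mul_of_lt {M : Type*} [CommMonoid M] (φ : ℕ → M)
    (ht : 0 < t) (ht' : t < cycleLen σ a) :
    cycleProd φ (swap a ((σ ^ t) a) * σ) * φ (cycleLen σ a) =
      φ t * φ (cycleLen σ a - t) * cycleProd φ σ := by
  have h := cycleProd_swap_mul_of_not_sameCycle φ (not_sameCycle_swap_mul ht ht')
  rw [cycleLen_swap_mul_left ht ht', cycleLen_swap_mul_right ht ht', swap_mul_self_mul,
    Nat.add_sub_cancel' ht'.le] at h
  rw [mul_comm, ← h, mul_comm]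

end Cut

end Cycles

/-! ### Hyperbolic weights of permutations -/

section Hyperbolic
variable {K : Type*} [Field K] (u : K)

/-- `u ^ l - u ^ (-l)`; for `u = exp (x / 2)` this is `2 sinh (l x / 2)`. -/
def qSinh (l : ℕ) : K := u ^ l - u⁻¹ ^ l

/-- `(u ^ l + u ^ (-l)) / (u ^ l - u ^ (-l))`; for `u = exp (x / 2)` this is `coth (l x / 2)`. -/
def qCoth (l : ℕ) : K := (u ^ l + u⁻¹ ^ l) / qSinh u l

variable {u}

lemma qSinh_mul_qCoth {l : ℕ} (h : qSinh u l ≠ 0) : qSinh u l * qCoth u l = u ^ l + u⁻¹ ^ l := by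
  rw [qCoth, mul_div_cancel₀ _ h]

lemma two_mul_qSinh_add {a b : ℕ} (ha : qSinh u a ≠ 0) (hb : qSinh u b ≠ 0) :
    2 * qSinh u (a + b) = qSinh u a * qSinh u b * (qCoth u a + qCoth u b) := by
  have h : qSinh u a * qSinh u b * (qCoth u a + qCoth u b) =
      qSinh u b * (qSinh u a * qCoth u a) + qSinh u a * (qSinh u b * qCoth u b) := by ring
  rw [h, qSinh_mul_qCoth ha, qSinh_mul_qCoth hb, qSinh, qSinh, qSinh, pow_add, pow_add]
  ring

/-- Subtraction formula for the hyperbolic sine. -/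
lemma two_mul_qSinh_mul_qSinh_one (hu : u ≠ 0) {k : ℕ} (h1 : qSinh u 1 ≠ 0)
    (hk : qSinh u (k + 1) ≠ 0) :
    2 * qSinh u k = qSinh u (k + 1) * qSinh u 1 * (qCoth u 1 - qCoth u (k + 1)) := by
  have h : qSinh u (k + 1) * qSinh u 1 * (qCoth u 1 - qCoth u (k + 1)) =
      qSinh u (k + 1) * (qSinh u 1 * qCoth u 1) -
        qSinh u 1 * (qSinh u (k + 1) * qCoth u (k + 1)) := by ring
  rw [h, qSinh_mul_qCoth h1, qSinh_mul_qCoth hk, qSinh, qSinh, qSinh, pow_succ, pow_succ]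
  linear_combination (-2 * (u ^ k - u⁻¹ ^ k)) * mul_inv_cancel₀ hu

/-- A geometric sum, together with its image under `u ↦ u⁻¹`. -/
lemma sum_pow_mul_pow_mul_qSinh (hu : u ≠ 0) (k : ℕ) :
    (∑ t ∈ Finset.Ico 1 (k + 1), (u ^ t * u⁻¹ ^ (k + 1 - t) + u⁻¹ ^ t * u ^ (k + 1 - t))) *
      qSinh u 1 = 2 * qSinh u k := by
  have key : ∀ v w : K, v * w = 1 →
      (∑ t ∈ Finset.Ico 1 (k + 1), v ^ t * w ^ (k + 1 - t)) * (v - w) = v ^ k - w ^ k := by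
    intro v w hvw
    rw [Finset.sum_Ico_eq_sum_range, ← geom_sum₂_mul]
    congr 1
    refine Finset.sum_congr rfl fun i hi => ?_
    have hi := Finset.mem_range.1 hi
    rw [show k + 1 - (1 + i) = (k - 1 - i) + 1 by omega, add_comm 1 i, pow_succ, pow_succ]
    linear_combination (v ^ i * w ^ (k - 1 - i)) * hvw
  have h1 := key u u⁻¹ (mul_inv_cancel₀ hu)
  have h2 := key u⁻¹ u (inv_mul_cancel₀ hu)
  rw [Finset.sum_add_distrib, add_mul, qSinh, pow_one, pow_one, h1, qSinh]
  linear_combination -h2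

/-- The total weight of the ways to cut a cycle of length `β` at a given point. -/
lemma sum_qSinh_mul_qSinh (hu : u ≠ 0) {β : ℕ} (hβ : 0 < β) (h1 : qSinh u 1 ≠ 0)
    (hb : qSinh u β ≠ 0) :
    ∑ t ∈ Finset.Ico 1 β, qSinh u t * qSinh u (β - t) =
      qSinh u β * (β * qCoth u β - qCoth u 1) := by
  obtain ⟨k, rfl⟩ : ∃ k, β = k + 1 := ⟨_, (Nat.succ_pred_eq_of_pos hβ).symm⟩
  have hterm : ∀ t ∈ Finset.Ico 1 (k + 1), qSinh u t * qSinh u (k + 1 - t) =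
      qSinh u (k + 1) * qCoth u (k + 1) -
        (u ^ t * u⁻¹ ^ (k + 1 - t) + u⁻¹ ^ t * u ^ (k + 1 - t)) := by
    intro t ht
    have ht := Finset.mem_Ico.1 ht
    rw [qSinh_mul_qCoth hb, qSinh, qSinh]
    have e1 : u ^ (k + 1) = u ^ t * u ^ (k + 1 - t) := by rw [← pow_add]; congr 1; omega
    have e2 : u⁻¹ ^ (k + 1) = u⁻¹ ^ t * u⁻¹ ^ (k + 1 - t) := by rw [← pow_add]; congr 1; omega
    rw [e1, e2]
    ring
  rw [Finset.sum_congr rfl hterm, Finset.sum_sub_distrib, Finset.sum_const, Nat.card_Ico,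
    nsmul_eq_mul]
  apply mul_right_cancel₀ h1
  have h2 := sum_pow_mul_pow_mul_qSinh hu k
  have h3 := two_mul_qSinh_mul_qSinh_one hu h1 hb
  push_cast
  rw [sub_mul, h2, h3]
  ring

section Perm
variable {α : Type*} [Fintype α] [DecidableEq α]

/-- The addition formula makes the weight of a join additive in the two cycles. -/
lemma cycleProd_qSinh_swap_mul_of_not_sameCycle (hs : ∀ l, 0 < l → qSinh u l ≠ 0) {σ : Perm α}
    {a b : α} (hab : ¬ σ.SameCycle a b) :
    2 * cycleProd (qSinh u) (swap a b * σ) =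
      cycleProd (qSinh u) σ * (qCoth u (cycleLen σ a) + qCoth u (cycleLen σ b)) := by
  have ha := hs _ (cycleLen_pos σ a)
  have hb := hs _ (cycleLen_pos σ b)
  apply mul_right_cancel₀ (mul_ne_zero ha hb)
  rw [mul_assoc, cycleProd_swap_mul_of_not_sameCycle _ hab, ← mul_assoc, two_mul_qSinh_add ha hb]
  ring

lemma sum_cycleClass_erase {M : Type*} [AddCommMonoid M] (σ : Perm α) (a : α) (X : α → M) :
    ∑ b ∈ (cycleClass σ a).erase a, X b = ∑ t ∈ Finset.Ico 1 (cycleLen σ a), X ((σ ^ t) a) := by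
  symm
  apply Finset.sum_bij (fun t _ => (σ ^ t) a)
  · intro t ht
    have ht := Finset.mem_Ico.1 ht
    refine Finset.mem_erase.2 ⟨fun h => ?_, mem_cycleClass.2
      (sameCycle_pow_right.2 (SameCycle.refl _ _))⟩
    exact absurd (eq_of_pow_apply_eq (j := 0) ht.2 (cycleLen_pos σ a) h) (by omega)
  · intro s hs t ht h
    exact eq_of_pow_apply_eq (Finset.mem_Ico.1 hs).2 (Finset.mem_Ico.1 ht).2 h
  · intro b hb
    obtain ⟨h1, h2⟩ := Finset.mem_erase.1 hb
    rw [cycleClass_eq_image_range] at h2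
    obtain ⟨t, ht, rfl⟩ := Finset.mem_image.1 h2
    refine ⟨t, Finset.mem_Ico.2 ⟨Nat.one_le_iff_ne_zero.2 ?_, Finset.mem_range.1 ht⟩, rfl⟩
    rintro rfl
    exact h1 rfl
  · intros; rfl

/-- The total weight of the products of `σ` with the transpositions that move `a`. The points `b` in
the cycle of `a`, whose transpositions cut it, contribute on the right just as all other points do;
the correction is `2 * qCoth u 1`. -/
lemma two_mul_sum_cycleProd_swap_mul (hu : u ≠ 0) (hs : ∀ l, 0 < l → qSinh u l ≠ 0)
    (σ : Perm α) (a : α) :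
    2 * ∑ b ∈ Finset.univ.erase a, cycleProd (qSinh u) (swap a b * σ) =
      cycleProd (qSinh u) σ *
        (∑ b, (qCoth u (cycleLen σ a) + qCoth u (cycleLen σ b)) - 2 * qCoth u 1) := by
  set β := cycleLen σ a with hβ
  have hβpos : 0 < β := cycleLen_pos σ a
  have hsplit : (Finset.univ : Finset α).erase a =
      (cycleClass σ a).erase a ∪ (cycleClass σ a)ᶜ := by
    ext b
    simp only [Finset.mem_erase, Finset.mem_univ, and_true, Finset.mem_union, Finset.mem_compl]
    constructor
    · intro h
      by_cases hb : b ∈ cycleClass σ a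
      · exact Or.inl ⟨h, hb⟩
      · exact Or.inr hb
    · rintro (h | h)
      · exact h.1
      · rintro rfl
        exact h (self_mem_cycleClass σ b)
  have hdisj : _root_.Disjoint ((cycleClass σ a).erase a) (cycleClass σ a)ᶜ :=
    Finset.disjoint_of_subset_left (Finset.erase_subset _ _) disjoint_compl_right
  have hcut : ∑ b ∈ (cycleClass σ a).erase a, cycleProd (qSinh u) (swap a b * σ) =
      cycleProd (qSinh u) σ * (β * qCoth u β - qCoth u 1) := by
    rw [sum_cycleClass_erase]
    apply mul_right_cancel₀ (hs β hβpos)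
    rw [Finset.sum_mul, mul_assoc, mul_comm _ (qSinh u β),
      ← sum_qSinh_mul_qSinh hu hβpos (hs 1 one_pos) (hs β hβpos), Finset.mul_sum]
    refine Finset.sum_congr rfl fun t ht => ?_
    have ht := Finset.mem_Ico.1 ht
    rw [cycleProd_swap_mul_of_lt _ (by omega) ht.2]
    ring
  have hjoin : 2 * ∑ b ∈ (cycleClass σ a)ᶜ, cycleProd (qSinh u) (swap a b * σ) =
      cycleProd (qSinh u) σ *
        ∑ b ∈ (cycleClass σ a)ᶜ, (qCoth u β + qCoth u (cycleLen σ b)) := by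
    rw [Finset.mul_sum, Finset.mul_sum]
    refine Finset.sum_congr rfl fun b hb => ?_
    rw [Finset.mem_compl, mem_cycleClass] at hb
    exact cycleProd_qSinh_swap_mul_of_not_sameCycle hs hb
  have hin : ∑ b ∈ cycleClass σ a, (qCoth u β + qCoth u (cycleLen σ b)) = 2 * (β * qCoth u β) := by
    have : ∀ b ∈ cycleClass σ a, qCoth u β + qCoth u (cycleLen σ b) = 2 * qCoth u β := by
      intro b hb
      rw [← cycleLen_eq_of_sameCycle (mem_cycleClass.1 hb), ← hβ, two_mul]
    rw [Finset.sum_congr rfl this, Finset.sum_const, nsmul_eq_mul, ← cycleLen, ← hβ]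
    ring
  rw [hsplit, Finset.sum_union hdisj, mul_add, hcut, hjoin,
    ← Finset.sum_add_sum_compl (cycleClass σ a), hin]
  ring

/-- The weight of `σ` with `σ⁻¹ a` removed from the cycle of `a`. If `a` is a fixed point, the sum is
empty and the right-hand side vanishes as well. -/
lemma two_mul_sum_cycleProd_swap_mul_of_apply_eq (hu : u ≠ 0)
    (hs : ∀ l, 0 < l → qSinh u l ≠ 0) (σ : Perm α) (a : α) :
    2 * ∑ b ∈ (Finset.univ.erase a).filter (fun b => σ b = a),
        cycleProd (qSinh u) (swap a b * σ) =
      cycleProd (qSinh u) σ * qSinh u 1 ^ 2 * (qCoth u 1 - qCoth u (cycleLen σ a)) := by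
  by_cases h : σ a = a
  · have h1 : cycleLen σ a = 1 := by rw [cycleLen, cycleClass_of_fixed h, Finset.card_singleton]
    have h2 : (Finset.univ.erase a).filter (fun b => σ b = a) = ∅ := by
      ext b
      simp only [Finset.mem_filter, Finset.mem_erase, Finset.mem_univ, and_true,
        Finset.notMem_empty, iff_false, not_and]
      intro hb hb'
      exact hb (σ.injective (hb'.trans h.symm))
    rw [h1, h2]
    simp
  · have hβpos := cycleLen_pos σ a
    have hpow := pow_cycleLen_apply σ a
    have hβ1 : cycleLen σ a ≠ 1 := fun h1 => h (by rwa [h1, pow_one] at hpow)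
    obtain ⟨k, hk⟩ : ∃ k, cycleLen σ a = k + 1 := ⟨_, (Nat.succ_pred_eq_of_pos hβpos).symm⟩
    have hlt : k < cycleLen σ a := by omega
    rw [hk, pow_succ', Perm.mul_apply] at hpow
    have h2 : (Finset.univ.erase a).filter (fun b => σ b = a) = {(σ ^ k) a} := by
      ext b
      simp only [Finset.mem_filter, Finset.mem_erase, Finset.mem_univ, and_true,
        Finset.mem_singleton]
      constructor
      · rintro ⟨-, hb⟩
        exact σ.injective (hb.trans hpow.symm)
      · rintro rfl
        refine ⟨fun h' => ?_, hpow⟩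
        rw [h'] at hpow
        exact h hpow
    have h3 := cycleProd_swap_mul_of_lt (qSinh u) (by omega) hlt
    have hk' := hs (k + 1) (by omega)
    rw [hk, Nat.add_sub_cancel_left] at h3
    rw [h2, Finset.sum_singleton, hk]
    apply mul_right_cancel₀ hk'
    rw [mul_assoc, h3]
    have h4 := two_mul_qSinh_mul_qSinh_one hu (hs 1 one_pos) hk'
    linear_combination (cycleProd (qSinh u) σ * qSinh u 1) * h4

end Perm

end Hyperbolic

/-! ### The formal power series `2 sinh (l X / 2)` and their logarithmic derivatives -/

section Series

/-- The power series `exp (X / 2)`. -/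
noncomputable def expHalf : ℚ⟦X⟧ := rescale (1 / 2 : ℚ) (exp ℚ)

/-- The power series `exp (-X / 2)`. -/
noncomputable def expNegHalf : ℚ⟦X⟧ := rescale (-1 / 2 : ℚ) (exp ℚ)

/-- The power series `2 sinh (l X / 2)`. -/
noncomputable def sinhSeries (l : ℕ) : ℚ⟦X⟧ := expHalf ^ l - expNegHalf ^ l

/-- The quotient `sinh (l X / 2) / sinh (X / 2)`, written as a geometric sum so that it is a power
series by definition. -/
noncomputable def sinhQuot (l : ℕ) : ℚ⟦X⟧ :=
  ∑ i ∈ Finset.range l, expHalf ^ i * expNegHalf ^ (l - 1 - i)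

lemma expHalf_mul_expNegHalf : expHalf * expNegHalf = 1 := by
  rw [expHalf, expNegHalf, exp_mul_exp_eq_exp_add]
  norm_num

lemma derivative_rescale_exp (a : ℚ) :
    derivative ℚ (rescale a (exp ℚ)) = C a * rescale a (exp ℚ) := by
  ext n
  rw [coeff_derivative, coeff_rescale, coeff_C_mul, coeff_rescale, coeff_exp, coeff_exp]
  simp only [Algebra.algebraMap_self, RingHom.id_apply, Nat.factorial_succ]
  have := Nat.factorial_ne_zero n
  push_cast
  field_simp
  ring

lemma derivative_expHalf_pow (l : ℕ) :
    derivative ℚ (expHalf ^ l) = C ((l : ℚ) / 2) * expHalf ^ l := by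
  cases l with
  | zero => simp
  | succ k =>
    rw [derivative_pow, expHalf, derivative_rescale_exp, Nat.add_sub_cancel, pow_succ,
      ← map_natCast (C (R := ℚ)), show ((k + 1 : ℕ) : ℚ) / 2 = (k + 1 : ℕ) * (1 / 2) by ring,
      map_mul]
    ring

lemma derivative_expNegHalf_pow (l : ℕ) :
    derivative ℚ (expNegHalf ^ l) = -C ((l : ℚ) / 2) * expNegHalf ^ l := by
  cases l with
  | zero => simp
  | succ k =>
    rw [derivative_pow, expNegHalf, derivative_rescale_exp, Nat.add_sub_cancel, pow_succ,
      ← map_natCast (C (R := ℚ)), ← map_neg,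
      show -(((k + 1 : ℕ) : ℚ) / 2) = (k + 1 : ℕ) * (-1 / 2) by ring, map_mul]
    ring

lemma derivative_sinhSeries (l : ℕ) :
    derivative ℚ (sinhSeries l) = C ((l : ℚ) / 2) * (expHalf ^ l + expNegHalf ^ l) := by
  rw [sinhSeries, map_sub, derivative_expHalf_pow, derivative_expNegHalf_pow]
  ring

lemma constantCoeff_expHalf : constantCoeff expHalf = 1 := by
  simp [expHalf, ← coeff_zero_eq_constantCoeff_apply, coeff_rescale]

lemma constantCoeff_expNegHalf : constantCoeff expNegHalf = 1 := by
  simp [expNegHalf, ← coeff_zero_eq_constantCoeff_apply, coeff_rescale]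

lemma constantCoeff_sinhSeries (l : ℕ) : constantCoeff (sinhSeries l) = 0 := by
  simp [sinhSeries, constantCoeff_expHalf, constantCoeff_expNegHalf]

lemma constantCoeff_sinhQuot (l : ℕ) : constantCoeff (sinhQuot l) = l := by
  simp [sinhQuot, constantCoeff_expHalf, constantCoeff_expNegHalf]

lemma sinhQuot_one : sinhQuot 1 = 1 := by simp [sinhQuot]

lemma sinhSeries_eq_mul (l : ℕ) : sinhSeries l = sinhQuot l * sinhSeries 1 := by
  rw [sinhSeries, sinhSeries, sinhQuot, pow_one, pow_one, geom_sum₂_mul]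

lemma sinhSeries_ne_zero {l : ℕ} (hl : 0 < l) : sinhSeries l ≠ 0 := by
  intro h
  have h1 := congrArg constantCoeff (derivative_sinhSeries l)
  rw [h, map_zero, map_zero, map_mul, constantCoeff_C, map_add, map_pow, map_pow,
    constantCoeff_expHalf, constantCoeff_expNegHalf] at h1
  have : (l : ℚ) ≠ 0 := by exact_mod_cast hl.ne'
  apply this
  simp only [one_pow] at h1
  linarith

lemma sinhQuot_ne_zero {l : ℕ} (hl : 0 < l) : sinhQuot l ≠ 0 := by
  intro h
  apply sinhSeries_ne_zero hl
  rw [sinhSeries_eq_mul, h, zero_mul]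

/-- The field in which quotients of formal power series are computed. -/
abbrev SeriesField : Type := FractionRing ℚ⟦X⟧

/-- The embedding of the formal power series into their field of fractions. -/
noncomputable abbrev toField : ℚ⟦X⟧ →+* SeriesField := algebraMap ℚ⟦X⟧ SeriesField

instance : CharZero SeriesField := algebraRat.charZero SeriesField

lemma toField_injective : Function.Injective toField := IsFractionRing.injective ℚ⟦X⟧ SeriesField

lemma toField_ne_zero {P : ℚ⟦X⟧} (h : P ≠ 0) : toField P ≠ 0 := by
  rwa [Ne, map_eq_zero_iff _ toField_injective]

lemma toField_expHalf_ne_zero : toField expHalf ≠ 0 :=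
  toField_ne_zero fun h => by
    have := expHalf_mul_expNegHalf
    rw [h, zero_mul] at this
    exact zero_ne_one this

lemma inv_toField_expHalf : (toField expHalf)⁻¹ = toField expNegHalf := by
  apply inv_eq_of_mul_eq_one_right
  rw [← map_mul, expHalf_mul_expNegHalf, map_one]

lemma toField_sinhSeries (l : ℕ) : toField (sinhSeries l) = qSinh (toField expHalf) l := by
  rw [qSinh, inv_toField_expHalf, sinhSeries, map_sub, map_pow, map_pow]

lemma qSinh_expHalf_ne_zero (l : ℕ) (hl : 0 < l) : qSinh (toField expHalf) l ≠ 0 := by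
  rw [← toField_sinhSeries]
  exact toField_ne_zero (sinhSeries_ne_zero hl)

/-- The logarithmic derivative of a power series, in the field of fractions. -/
noncomputable def dlog (P : ℚ⟦X⟧) : SeriesField := toField (derivative ℚ P) / toField P

lemma toField_derivative {P : ℚ⟦X⟧} (h : P ≠ 0) :
    toField (derivative ℚ P) = toField P * dlog P := by
  rw [dlog, mul_div_cancel₀ _ (toField_ne_zero h)]

lemma dlog_one : dlog 1 = 0 := by
  rw [dlog, Derivation.map_one_eq_zero, map_zero, zero_div]

lemma dlog_C (a : ℚ) : dlog (C a) = 0 := by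
  rw [dlog, derivative_C, map_zero, zero_div]

lemma dlog_mul {P Q : ℚ⟦X⟧} (hP : P ≠ 0) (hQ : Q ≠ 0) : dlog (P * Q) = dlog P + dlog Q := by
  have h1 := toField_ne_zero hP
  have h2 := toField_ne_zero hQ
  rw [dlog, dlog, dlog, Derivation.leibniz, smul_eq_mul, smul_eq_mul, map_add, map_mul, map_mul,
    map_mul]
  field_simp
  ring

lemma dlog_pow {P : ℚ⟦X⟧} (hP : P ≠ 0) (k : ℕ) : dlog (P ^ k) = k * dlog P := by
  induction k with
  | zero => simp [dlog_one]
  | succ k ih =>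
    rw [pow_succ, dlog_mul (pow_ne_zero _ hP) hP, ih]
    push_cast
    ring

lemma dlog_multiset_prod (s : Multiset ℚ⟦X⟧) (h : ∀ P ∈ s, P ≠ 0) :
    dlog s.prod = (s.map dlog).sum := by
  induction s using Multiset.induction_on with
  | empty => simp [dlog_one]
  | cons P s ih =>
    rw [Multiset.prod_cons, Multiset.map_cons, Multiset.sum_cons, dlog_mul, ih]
    · exact fun Q hQ => h Q (Multiset.mem_cons_of_mem hQ)
    · exact h P (Multiset.mem_cons_self _ _)
    · exact Multiset.prod_ne_zero fun h0 => h 0 (Multiset.mem_cons_of_mem h0) rfl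

lemma toField_C (a : ℚ) : toField (C a) = (a : SeriesField) := by
  have : (toField.comp C : ℚ →+* SeriesField) = algebraMap ℚ SeriesField := Subsingleton.elim _ _
  rw [← RingHom.comp_apply, this, eq_ratCast]

lemma two_mul_dlog_sinhSeries (l : ℕ) :
    2 * dlog (sinhSeries l) = l * qCoth (toField expHalf) l := by
  rw [dlog, derivative_sinhSeries, qCoth, ← toField_sinhSeries, map_mul, toField_C, map_add,
    map_pow, map_pow, inv_toField_expHalf, Rat.cast_div, Rat.cast_natCast, Rat.cast_ofNat]
  ring

lemma two_mul_dlog_sinhQuot {l : ℕ} (hl : 0 < l) :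
    2 * dlog (sinhQuot l) = l * qCoth (toField expHalf) l - qCoth (toField expHalf) 1 := by
  have h := two_mul_dlog_sinhSeries l
  rw [sinhSeries_eq_mul, dlog_mul (sinhQuot_ne_zero hl) (sinhSeries_ne_zero one_pos), mul_add,
    two_mul_dlog_sinhSeries] at h
  linear_combination h

variable {n : ℕ}

lemma cycleProd_sinhQuot_ne_zero (σ : Perm (Fin n)) : cycleProd sinhQuot σ ≠ 0 := by
  refine Multiset.prod_ne_zero fun h => ?_
  obtain ⟨l, hl, h0⟩ := Multiset.mem_map.1 h
  exact sinhQuot_ne_zero (σ.partition.parts_pos hl) h0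

/-- The logarithmic derivative of the weight of a permutation, as a sum over points: a cycle of
length `l` contributes `l * qCoth l`, hence `qCoth l` for each of its points. -/
lemma two_mul_dlog_cycleProd_sinhQuot (σ : Perm (Fin n)) :
    2 * dlog (cycleProd sinhQuot σ) =
      ∑ x, qCoth (toField expHalf) (cycleLen σ x) - numCycles σ * qCoth (toField expHalf) 1 := by
  rw [cycleProd, dlog_multiset_prod, Multiset.map_map, ← Multiset.sum_map_mul_left, sum_cycleLen,
    numCycles, ← nsmul_eq_mul, ← Multiset.sum_replicate, ← Multiset.map_const',
    ← Multiset.sum_map_sub]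
  · congr 1
    refine Multiset.map_congr rfl fun l hl => ?_
    rw [Function.comp_apply, two_mul_dlog_sinhQuot (σ.partition.parts_pos hl), nsmul_eq_mul]
  · intro P hP
    obtain ⟨l, hl, rfl⟩ := Multiset.mem_map.1 hP
    exact sinhQuot_ne_zero (σ.partition.parts_pos hl)

lemma toField_cycleProd_sinhQuot (σ : Perm (Fin n)) :
    toField (cycleProd sinhQuot σ) * qSinh (toField expHalf) 1 ^ numCycles σ =
      cycleProd (qSinh (toField expHalf)) σ := by
  rw [cycleProd, cycleProd, map_multiset_prod, Multiset.map_map, numCycles,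
    ← Multiset.prod_replicate, ← Multiset.map_const', ← Multiset.prod_map_mul]
  congr 1
  refine Multiset.map_congr rfl fun l _ => ?_
  rw [Function.comp_apply, ← toField_sinhSeries, ← toField_sinhSeries, ← map_mul,
    ← sinhSeries_eq_mul]

end Series

/-! ### The explicit generating function of star factorizations -/

section StarSolution
variable {n : ℕ}

lemma numCycles_eq (σ : Perm (Fin n)) :
    numCycles σ = σ.cycleType.card + (n - σ.support.card) := by
  rw [numCycles, parts_partition, Multiset.card_add, Multiset.card_replicate, Fintype.card_fin]

/-- The power of `sinhSeries 1` in `starSolution` is a truncated subtraction; this shows that it does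
not truncate. -/
lemma le_numCycles_add_card {p : Fin n} {S : Finset (Fin n)} {σ : Perm (Fin n)}
    (h : σ.support ⊆ insert p S) : n ≤ numCycles σ + S.card := by
  have h1 : σ.support.card ≤ S.card + 1 := (Finset.card_le_card h).trans (Finset.card_insert_le _ _)
  rw [numCycles_eq]
  by_cases hσ : σ = 1
  · subst hσ
    rw [support_one, Finset.card_empty]
    omega
  · have : 0 < σ.cycleType.card := by
      rw [Multiset.card_pos]
      exact fun h0 => hσ (cycleType_eq_zero.1 h0)
    omega

lemma numCycles_pos (p : Fin n) (σ : Perm (Fin n)) : 0 < numCycles σ := by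
  rw [numCycles, Multiset.card_pos]
  intro h
  have := σ.partition.parts_sum
  rw [h, Multiset.sum_zero, Fintype.card_fin] at this
  have := p.pos
  omega

open Classical in
/-- The explicit exponential generating function, by length, of the products of star transpositions
`(p i)` with value `σ` in which the indices `i` are exactly the elements of `S`. It is
`(2 sinh (X / 2)) ^ (k - 2) * ∏ 2 sinh (l X / 2) / k!` with `k = |S| + 1`, where `l` runs over the
lengths of the cycles of `σ` on `S ∪ {p}`. The fixed points of `σ` outside of `S ∪ {p}` do no harm
in `cycleProd`, as `sinhQuot 1 = 1`. If `σ` moves some point outside of `S ∪ {p}`, there are no such products and the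
series is `0`. -/
noncomputable def starSolution (p : Fin n) (S : Finset (Fin n)) (σ : Perm (Fin n)) : ℚ⟦X⟧ :=
  if σ.support ⊆ insert p S then
    C (1 / ((S.card + 1).factorial : ℚ)) *
      (sinhSeries 1 ^ (2 * S.card + numCycles σ - n) * cycleProd sinhQuot σ)
  else 0

variable {p : Fin n} {S : Finset (Fin n)} {σ : Perm (Fin n)}

/-- `starSolution` in terms of the weights `qSinh`. The factor `qSinh _ 1 ^ n` clears denominators. -/
lemma toField_starSolution (h : σ.support ⊆ insert p S) :
    toField (starSolution p S σ) * qSinh (toField expHalf) 1 ^ n * ((S.card + 1).factorial : ℕ) =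
      qSinh (toField expHalf) 1 ^ (2 * S.card) * cycleProd (qSinh (toField expHalf)) σ := by
  have h1 := le_numCycles_add_card h
  have h2 : ((S.card + 1).factorial : SeriesField) ≠ 0 := by
    exact_mod_cast Nat.factorial_ne_zero _
  rw [starSolution, if_pos h, map_mul, map_mul, map_pow, toField_C, toField_sinhSeries,
    ← toField_cycleProd_sinhQuot]
  have h3 : qSinh (toField expHalf) 1 ^ (2 * S.card + numCycles σ - n) *
      qSinh (toField expHalf) 1 ^ n =
      qSinh (toField expHalf) 1 ^ (2 * S.card) * qSinh (toField expHalf) 1 ^ numCycles σ := by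
    rw [← pow_add, ← pow_add]
    congr 1
    omega
  rw [Rat.cast_div, Rat.cast_one, Rat.cast_natCast]
  have h4 : (1 / ((S.card + 1).factorial : SeriesField)) *
      ((S.card + 1).factorial : SeriesField) = 1 := one_div_mul_cancel h2
  linear_combination (toField (cycleProd sinhQuot σ) *
    (1 / ((S.card + 1).factorial : SeriesField)) * ((S.card + 1).factorial : SeriesField)) * h3 +
    (toField (cycleProd sinhQuot σ) * (qSinh (toField expHalf) 1 ^ (2 * S.card) *
      qSinh (toField expHalf) 1 ^ numCycles σ)) * h4

lemma toField_derivative_starSolution (h : σ.support ⊆ insert p S) :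
    2 * toField (derivative ℚ (starSolution p S σ)) = toField (starSolution p S σ) *
      (∑ x, qCoth (toField expHalf) (cycleLen σ x) +
        (2 * S.card - n) * qCoth (toField expHalf) 1) := by
  have h1 := le_numCycles_add_card h
  have hf : sinhSeries 1 ≠ 0 := sinhSeries_ne_zero one_pos
  have hC : (C (1 / ((S.card + 1).factorial : ℚ)) : ℚ⟦X⟧) ≠ 0 := by
    rw [Ne, map_eq_zero_iff _ C_injective]
    exact one_div_ne_zero (by exact_mod_cast Nat.factorial_ne_zero _)
  have hne : starSolution p S σ ≠ 0 := by
    rw [starSolution, if_pos h]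
    exact mul_ne_zero hC (mul_ne_zero (pow_ne_zero _ hf) (cycleProd_sinhQuot_ne_zero σ))
  rw [toField_derivative hne, mul_left_comm]
  congr 1
  rw [starSolution, if_pos h, dlog_mul hC (mul_ne_zero (pow_ne_zero _ hf)
    (cycleProd_sinhQuot_ne_zero σ)), dlog_C, dlog_mul (pow_ne_zero _ hf)
    (cycleProd_sinhQuot_ne_zero σ), dlog_pow hf, zero_add, mul_add,
    two_mul_dlog_cycleProd_sinhQuot, mul_left_comm, two_mul_dlog_sinhSeries,
    Nat.cast_sub (by omega)]
  push_cast
  ring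

lemma support_swap_mul_subset {a b : Fin n} {T : Finset (Fin n)} (ha : a ∈ T) (hb : b ∈ T) :
    (swap a b * σ).support ⊆ T ↔ σ.support ⊆ T := by
  have key : ∀ τ : Perm (Fin n), τ.support ⊆ T → (swap a b * τ).support ⊆ T := by
    intro τ hτ x hx
    by_contra hxT
    have h1 : τ x = x := notMem_support.1 fun h => hxT (hτ h)
    rw [mem_support, Perm.mul_apply, h1, swap_apply_of_ne_of_ne] at hx
    · exact hx rfl
    · rintro rfl; exact hxT ha
    · rintro rfl; exact hxT hb
  refine ⟨fun h => ?_, key σ⟩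
  have := key _ h
  rwa [swap_mul_self_mul] at this

/-- The product with `swap p i` fixes `i` only if `i` precedes `p` in its cycle. -/
lemma support_swap_mul_subset_erase (hp : p ∉ S) {i : Fin n} (hi : i ∈ S)
    (h : σ.support ⊆ insert p S) :
    (swap p i * σ).support ⊆ insert p (S.erase i) ↔ σ i = p := by
  have hip : i ≠ p := fun h => hp (h ▸ hi)
  constructor
  · intro h'
    have : i ∉ (swap p i * σ).support := fun hi' => by
      have := h' hi'
      simp [hip] at this
    rwa [notMem_support, Perm.mul_apply, swap_apply_eq_iff, swap_apply_right] at this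
  · intro h'
    have h1 : (swap p i * σ).support ⊆ insert p S :=
      (support_swap_mul_subset (Finset.mem_insert_self _ _) (Finset.mem_insert_of_mem hi)).2 h
    intro x hx
    have hxi : x ≠ i := by
      rintro rfl
      rw [mem_support, Perm.mul_apply, h', swap_apply_left] at hx
      exact hx rfl
    have := h1 hx
    simp only [Finset.mem_insert, Finset.mem_erase] at this ⊢
    tauto

/-- The contribution of the first letters `i` that occur again later in the word. -/
lemma sum_starSolution_join (hp : p ∉ S) (h : σ.support ⊆ insert p S) :
    2 * (∑ i ∈ S, toField (starSolution p S (swap p i * σ))) =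
      toField (starSolution p S σ) *
        ((S.card + 1) * qCoth (toField expHalf) (cycleLen σ p) +
          ∑ x, qCoth (toField expHalf) (cycleLen σ x) -
          (n - S.card + 1) * qCoth (toField expHalf) 1) := by
  have hu := toField_expHalf_ne_zero
  have hs := qSinh_expHalf_ne_zero
  set u := toField expHalf with hu_def
  have hall := two_mul_sum_cycleProd_swap_mul hu hs σ p
  have hsub : S ⊆ Finset.univ.erase p := fun i hi =>
    Finset.mem_erase.2 ⟨fun h => hp (h ▸ hi), Finset.mem_univ _⟩
  rw [← Finset.sum_sdiff hsub] at hall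
  -- the points outside of `S` and different from `p` are fixed points of `σ`
  have hout : 2 * ∑ b ∈ Finset.univ.erase p \ S, cycleProd (qSinh u) (swap p b * σ) =
      (n - S.card - 1) *
        (cycleProd (qSinh u) σ * (qCoth u (cycleLen σ p) + qCoth u 1)) := by
    have hterm : ∀ b ∈ Finset.univ.erase p \ S, 2 * cycleProd (qSinh u) (swap p b * σ) =
        cycleProd (qSinh u) σ * (qCoth u (cycleLen σ p) + qCoth u 1) := by
      intro b hb
      obtain ⟨hb1, hb2⟩ := Finset.mem_sdiff.1 hb
      have hbp := (Finset.mem_erase.1 hb1).1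
      have hfix : σ b = b := notMem_support.1 fun hb3 => by
        have := h hb3
        simp [hbp, hb2] at this
      have hl : cycleLen σ b = 1 := by
        rw [cycleLen, cycleClass_of_fixed hfix, Finset.card_singleton]
      rw [cycleProd_qSinh_swap_mul_of_not_sameCycle hs, hl]
      exact fun hsc => hbp (hsc.eq_of_right hfix).symm
    have hcard : (Finset.univ.erase p \ S).card + S.card + 1 = n := by
      rw [Finset.card_sdiff_add_card_eq_card hsub, Finset.card_erase_of_mem (Finset.mem_univ p),
        Finset.card_univ, Fintype.card_fin]
      have := p.pos
      omega
    have hcard' : ((Finset.univ.erase p \ S).card : SeriesField) = n - S.card - 1 := by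
      have := congrArg (Nat.cast : ℕ → SeriesField) hcard
      push_cast at this
      linear_combination this
    rw [Finset.mul_sum, Finset.sum_congr rfl hterm, Finset.sum_const, nsmul_eq_mul, hcard']
  rw [mul_add, hout, Finset.sum_add_distrib, Finset.sum_const, Finset.card_univ,
    Fintype.card_fin, nsmul_eq_mul] at hall
  have hk : ((S.card + 1).factorial : SeriesField) ≠ 0 := by
    exact_mod_cast Nat.factorial_ne_zero _
  have hf : qSinh u 1 ^ n * ((S.card + 1).factorial : SeriesField) ≠ 0 :=
    mul_ne_zero (pow_ne_zero _ (hs 1 one_pos)) hk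
  apply mul_right_cancel₀ hf
  have hσ := toField_starSolution h
  have hsum : (∑ i ∈ S, toField (starSolution p S (swap p i * σ))) *
      (qSinh u 1 ^ n * ((S.card + 1).factorial : SeriesField)) =
      qSinh u 1 ^ (2 * S.card) * ∑ i ∈ S, cycleProd (qSinh u) (swap p i * σ) := by
    rw [Finset.sum_mul, Finset.mul_sum]
    refine Finset.sum_congr rfl fun i hi => ?_
    rw [← mul_assoc, toField_starSolution]
    exact (support_swap_mul_subset (Finset.mem_insert_self _ _) (Finset.mem_insert_of_mem hi)).2 h
  rw [mul_assoc 2, hsum]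
  linear_combination qSinh u 1 ^ (2 * S.card) * hall -
    ((S.card + 1) * qCoth u (cycleLen σ p) +
          ∑ x, qCoth u (cycleLen σ x) - (n - S.card + 1) * qCoth u 1) * hσ

/-- The contribution of the first letters `i` that do not occur again in the word. -/
lemma sum_starSolution_cut (hp : p ∉ S) (h : σ.support ⊆ insert p S) :
    2 * (∑ i ∈ S, toField (starSolution p (S.erase i) (swap p i * σ))) =
      toField (starSolution p S σ) * ((S.card + 1) *
        (qCoth (toField expHalf) 1 - qCoth (toField expHalf) (cycleLen σ p))) := by
  classical
  have hu := toField_expHalf_ne_zero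
  have hs := qSinh_expHalf_ne_zero
  set u := toField expHalf with hu_def
  have hall := two_mul_sum_cycleProd_swap_mul_of_apply_eq hu hs σ p
  have hfilter : (Finset.univ.erase p).filter (fun b => σ b = p) = S.filter (fun b => σ b = p) := by
    ext b
    simp only [Finset.mem_filter, Finset.mem_erase, Finset.mem_univ, and_true,
      and_congr_left_iff]
    intro hb
    refine ⟨fun hbp => ?_, fun hbS hbp => hp (hbp ▸ hbS)⟩
    have := h (mem_support.2 (fun h' => hbp (h'.symm.trans hb)))
    simpa [hbp] using this
  rw [hfilter] at hall
  have hk : (S.card.factorial : SeriesField) ≠ 0 := by exact_mod_cast Nat.factorial_ne_zero _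
  have hf : qSinh u 1 ^ n * (S.card.factorial : SeriesField) * qSinh u 1 ^ 2 ≠ 0 :=
    mul_ne_zero (mul_ne_zero (pow_ne_zero _ (hs 1 one_pos)) hk) (pow_ne_zero _ (hs 1 one_pos))
  apply mul_right_cancel₀ hf
  have hσ := toField_starSolution h
  -- a summand is nonzero only if `σ i = p`, which keeps the product supported on `S.erase i`
  have hsum : (∑ i ∈ S, toField (starSolution p (S.erase i) (swap p i * σ))) *
      (qSinh u 1 ^ n * (S.card.factorial : SeriesField) * qSinh u 1 ^ 2) =
      qSinh u 1 ^ (2 * S.card) *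
        ∑ i ∈ S.filter (fun b => σ b = p), cycleProd (qSinh u) (swap p i * σ) := by
    rw [Finset.sum_mul, Finset.mul_sum, Finset.sum_filter]
    refine Finset.sum_congr rfl fun i hi => ?_
    have hiff := support_swap_mul_subset_erase hp hi h
    split_ifs with hi'
    · have hcard := Finset.card_erase_add_one hi
      have h3 := toField_starSolution (hiff.2 hi')
      rw [← hu_def, hcard] at h3
      rw [← mul_assoc, ← mul_assoc, h3, ← hcard]
      ring
    · rw [starSolution, if_neg (fun h' => hi' (hiff.1 h')), map_zero, zero_mul]
  rw [mul_assoc 2, hsum]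
  rw [Nat.factorial_succ] at hσ
  push_cast at hσ
  linear_combination qSinh u 1 ^ (2 * S.card) * hall -
    (qSinh u 1 ^ 2 * (qCoth u 1 - qCoth u (cycleLen σ p))) * hσ

/-- The explicit solution satisfies the recurrence that removes the first letter of a word. -/
lemma derivative_starSolution (hp : p ∉ S) :
    derivative ℚ (starSolution p S σ) = ∑ i ∈ S, (starSolution p S (swap p i * σ) +
      starSolution p (S.erase i) (swap p i * σ)) := by
  by_cases h : σ.support ⊆ insert p S
  · apply toField_injective
    have h1 := sum_starSolution_join hp h
    have h2 := sum_starSolution_cut hp h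
    have h3 := toField_derivative_starSolution h
    rw [map_sum]
    simp only [map_add]
    rw [Finset.sum_add_distrib]
    apply mul_left_cancel₀ (two_ne_zero' SeriesField)
    linear_combination h3 - h1 - h2
  · rw [starSolution, if_neg h, map_zero]
    symm
    refine Finset.sum_eq_zero fun i hi => ?_
    have h1 : ¬ (swap p i * σ).support ⊆ insert p S := fun h' => h
      ((support_swap_mul_subset (Finset.mem_insert_self _ _) (Finset.mem_insert_of_mem hi)).1 h')
    have h2 : ¬ (swap p i * σ).support ⊆ insert p (S.erase i) := fun h' => h1
      (h'.trans (Finset.insert_subset_insert _ (Finset.erase_subset _ _)))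
    rw [starSolution, starSolution, if_neg h1, if_neg h2, add_zero]

lemma cycleProd_sinhQuot_one : cycleProd sinhQuot (1 : Perm (Fin n)) = 1 := by
  rw [cycleProd, parts_partition, cycleType_one, zero_add, Multiset.map_replicate, sinhQuot_one,
    Multiset.prod_replicate, one_pow]

lemma constantCoeff_starSolution (hp : p ∉ S) :
    constantCoeff (starSolution p S σ) = if S = ∅ ∧ σ = 1 then 1 else 0 := by
  by_cases h : σ.support ⊆ insert p S
  · have h1 := le_numCycles_add_card h
    rw [starSolution, if_pos h]
    by_cases hS : S = ∅
    · subst hS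
      have hσ : σ = 1 := by
        rw [← support_eq_empty_iff, ← Finset.card_eq_zero]
        have h2 := Finset.card_le_card h
        have h3 := card_support_ne_one σ
        rw [Finset.card_insert_of_notMem (Finset.notMem_empty p), Finset.card_empty] at h2
        omega
      have h4 : numCycles (1 : Perm (Fin n)) = n := by simp [numCycles_eq]
      rw [hσ, h4, cycleProd_sinhQuot_one]
      simp
    · have hpos : 0 < S.card := Finset.card_pos.2 (Finset.nonempty_iff_ne_empty.2 hS)
      rw [if_neg (fun h' => hS h'.1), map_mul, map_mul, map_pow, constantCoeff_sinhSeries,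
        zero_pow (by omega), zero_mul, mul_zero]
  · rw [starSolution, if_neg h, if_neg, map_zero]
    rintro ⟨-, rfl⟩
    simp at h

end StarSolution

/-! ### Counting star factorizations -/

section StarCount
variable {n : ℕ}

open Classical in
/-- The words `i₁ ⋯ iᵣ` whose set of letters is exactly `S` and for which the product of the star
transpositions `(p i₁) ⋯ (p iᵣ)` is `σ`. -/
noncomputable def starWords (p : Fin n) (r : ℕ) (S : Finset (Fin n)) (σ : Perm (Fin n)) :
    Finset (Fin r → Fin n) :=
  Finset.univ.filter fun w =>
    Finset.univ.image w = S ∧ (List.ofFn fun k => swap p (w k)).prod = σ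

lemma mem_starWords {p : Fin n} {r : ℕ} {S : Finset (Fin n)} {σ : Perm (Fin n)}
    {w : Fin r → Fin n} : w ∈ starWords p r S σ ↔
      Finset.univ.image w = S ∧ (List.ofFn fun k => swap p (w k)).prod = σ := by
  simp [starWords]

lemma card_starWords_zero (p : Fin n) (S : Finset (Fin n)) (σ : Perm (Fin n)) :
    (starWords p 0 S σ).card = if S = ∅ ∧ σ = 1 then 1 else 0 := by
  split_ifs with h
  · have : starWords p 0 S σ = {Fin.elim0} := by
      ext w
      simp [mem_starWords, h.1, h.2, Subsingleton.elim w Fin.elim0]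
    rw [this, Finset.card_singleton]
  · rw [Finset.card_eq_zero, Finset.eq_empty_iff_forall_notMem]
    intro w hw
    obtain ⟨h1, h2⟩ := mem_starWords.1 hw
    exact h ⟨by simpa using h1.symm, by simpa using h2.symm⟩

lemma cons_mem_starWords {p : Fin n} {r : ℕ} {S : Finset (Fin n)} {σ : Perm (Fin n)}
    {i : Fin n} (hi : i ∈ S) {w : Fin r → Fin n} :
    (Fin.cons i w : Fin (r + 1) → Fin n) ∈ starWords p (r + 1) S σ ↔
      w ∈ starWords p r S (swap p i * σ) ∪ starWords p r (S.erase i) (swap p i * σ) := by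
  have himg : Finset.univ.image (Fin.cons i w : Fin (r + 1) → Fin n) =
      insert i (Finset.univ.image w) := by
    ext x
    simp [Fin.exists_fin_succ, eq_comm]
  have hprod : (List.ofFn fun k => swap p ((Fin.cons i w : Fin (r + 1) → Fin n) k)).prod = σ ↔
      (List.ofFn fun k => swap p (w k)).prod = swap p i * σ := by
    rw [List.ofFn_succ, List.prod_cons]
    simp only [Fin.cons_zero, Fin.cons_succ]
    rw [← eq_inv_mul_iff_mul_eq, swap_inv]
  have hset : insert i (Finset.univ.image w) = S ↔
      Finset.univ.image w = S ∨ Finset.univ.image w = S.erase i := by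
    constructor
    · rintro rfl
      by_cases h : i ∈ Finset.univ.image w
      · exact Or.inl (Finset.insert_eq_of_mem h).symm
      · exact Or.inr (Finset.erase_insert h).symm
    · rintro (h | h)
      · rw [h, Finset.insert_eq_of_mem hi]
      · rw [h, Finset.insert_erase hi]
  rw [Finset.mem_union, mem_starWords, mem_starWords, mem_starWords, himg, hprod, hset,
    or_and_right]

lemma card_starWords_succ (p : Fin n) (r : ℕ) (S : Finset (Fin n)) (σ : Perm (Fin n)) :
    (starWords p (r + 1) S σ).card = ∑ i ∈ S, ((starWords p r S (swap p i * σ)).card +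
      (starWords p r (S.erase i) (swap p i * σ)).card) := by
  rw [Finset.card_eq_sum_card_fiberwise (f := fun w => w 0) (t := S)]
  · refine Finset.sum_congr rfl fun i hi => ?_
    have hdisj : _root_.Disjoint (starWords p r S (swap p i * σ))
        (starWords p r (S.erase i) (swap p i * σ)) := by
      rw [Finset.disjoint_left]
      intro w h1 h2
      have h3 := (mem_starWords.1 h1).1
      rw [(mem_starWords.1 h2).1] at h3
      exact Finset.erase_eq_self.1 h3 hi
    rw [← Finset.card_union_of_disjoint hdisj]
    symm
    refine Finset.card_bij (fun w _ => Fin.cons i w) ?_ ?_ ?_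
    · intro w hw
      exact Finset.mem_filter.2 ⟨(cons_mem_starWords hi).2 hw, rfl⟩
    · intro v _ w _ h
      exact Fin.cons_right_injective (α := fun _ => Fin n) i h
    · intro w hw
      obtain ⟨h1, h2⟩ := Finset.mem_filter.1 hw
      refine ⟨Fin.tail w, (cons_mem_starWords hi).1 ?_, ?_⟩ <;> rw [← h2, Fin.cons_self_tail]
      exact h1
  · intro w hw
    have := (mem_starWords.1 hw).1
    rw [← this]
    exact Finset.mem_coe.2 (Finset.mem_image_of_mem _ (Finset.mem_univ _))

/-- The coefficients of `starSolution` count star words, since both sides satisfy the same recurrence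
in the length, with the same initial values. -/
theorem card_starWords_div_factorial {p : Fin n} (r : ℕ) {S : Finset (Fin n)} (hp : p ∉ S)
    (σ : Perm (Fin n)) :
    ((starWords p r S σ).card : ℚ) / r.factorial = coeff r (starSolution p S σ) := by
  induction r generalizing S σ with
  | zero =>
    rw [coeff_zero_eq_constantCoeff_apply, constantCoeff_starSolution hp, card_starWords_zero]
    simp
  | succ r ih =>
    have h := congrArg (coeff r) (derivative_starSolution (σ := σ) hp)
    rw [coeff_derivative, map_sum] at h
    have hr : ((r : ℚ) + 1) ≠ 0 := by positivity
    apply mul_right_cancel₀ hr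
    rw [h, card_starWords_succ, Nat.factorial_succ]
    have hf : (r.factorial : ℚ) ≠ 0 := by exact_mod_cast Nat.factorial_ne_zero r
    push_cast
    rw [div_mul_eq_mul_div, mul_comm, mul_div_mul_left _ _ hr, Finset.sum_div]
    refine Finset.sum_congr rfl fun i _ => ?_
    rw [map_add, ← ih hp, ← ih fun h => hp (Finset.mem_of_mem_erase h), add_div]

/-- Star transpositions act transitively if and only if each of them occurs. -/
lemma generatesTransitive_iff {p : Fin n} {r : ℕ} {w : Fin r → Fin n} (hw : ∀ k, w k ≠ p) :
    GeneratesTransitive (Set.range fun k => swap p (w k)) ↔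
      Finset.univ.image w = Finset.univ.erase p := by
  set G := Subgroup.closure (Set.range fun k => swap p (w k)) with hG
  constructor
  · intro h
    have h : MulAction.IsPretransitive G (Fin n) := h
    ext i
    simp only [Finset.mem_image, Finset.mem_univ, true_and, Finset.mem_erase, and_true]
    constructor
    · rintro ⟨k, rfl⟩
      exact hw k
    · intro hip
      by_contra! hi
      have hle : G ≤ MulAction.stabilizer (Perm (Fin n)) i := by
        rw [hG, Subgroup.closure_le]
        rintro _ ⟨k, rfl⟩
        exact swap_apply_of_ne_of_ne hip (hi k).symm
      obtain ⟨⟨x, hx⟩, hxi⟩ := h.exists_smul_eq i p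
      exact hip ((hle hx).symm.trans hxi)
  · intro h
    have hmem : ∀ i, swap p i ∈ G := by
      intro i
      by_cases hi : i = p
      · rw [hi, swap_self]
        exact one_mem G
      · have : i ∈ Finset.univ.image w := by rw [h]; simp [hi]
        obtain ⟨k, -, rfl⟩ := Finset.mem_image.1 this
        exact Subgroup.subset_closure ⟨k, rfl⟩
    refine ⟨fun i j => ⟨⟨swap p j, hmem j⟩ * ⟨swap p i, hmem i⟩, ?_⟩⟩
    change swap p j (swap p i i) = j
    rw [swap_apply_right, swap_apply_left]

lemma ncard_starFactorizations (p : Fin n) (r : ℕ) (σ : Perm (Fin n)) :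
    (starFactorizations p r σ).ncard = (starWords p r (Finset.univ.erase p) σ).card := by
  rw [← Set.ncard_coe_finset]
  have hinj : Set.InjOn (fun (w : Fin r → Fin n) k => swap p (w k))
      (starWords p r (Finset.univ.erase p) σ) := by
    intro v _ w _ h
    funext k
    have h1 := congrFun h k
    have h2 := congrArg (fun τ : Perm (Fin n) => τ p) h1
    simpa using h2
  rw [← hinj.ncard_image]
  congr 1
  have hne : ∀ w ∈ starWords p r (Finset.univ.erase p) σ, ∀ k, w k ≠ p := by
    intro w hw k
    have h1 : w k ∈ Finset.univ.image w := Finset.mem_image_of_mem _ (Finset.mem_univ k)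
    rw [(mem_starWords.1 hw).1] at h1
    exact (Finset.mem_erase.1 h1).1
  ext τ
  constructor
  · rintro ⟨h1, h2, h3⟩
    choose w hw hw' using h1
    obtain rfl : τ = fun k => swap p (w k) := funext fun k => by rw [hw' k, swap_comm]
    exact ⟨w, mem_starWords.2 ⟨(generatesTransitive_iff hw).1 h3, h2⟩, rfl⟩
  · rintro ⟨w, hw, rfl⟩
    have hw' := mem_starWords.1 hw
    exact ⟨fun k => ⟨w k, hne w hw k, swap_comm _ _⟩, hw'.2,
      (generatesTransitive_iff (hne w hw)).2 hw'.1⟩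

end StarCount

/-! ### Counting factorizations into transpositions and a full cycle -/

section CycleCount
variable {n : ℕ}

open Classical in
/-- The transpositions of `Fin n`. -/
noncomputable def swaps (n : ℕ) : Finset (Perm (Fin n)) := Finset.univ.filter IsSwap

lemma mem_swaps {τ : Perm (Fin n)} : τ ∈ swaps n ↔ τ.IsSwap := by simp [swaps]

lemma two_mul_sum_swaps {M : Type*} [Semiring M] (X : Perm (Fin n) → M) :
    2 * ∑ τ ∈ swaps n, X τ = ∑ a, ∑ b ∈ Finset.univ.erase a, X (swap a b) := by
  classical
  have h : ∑ a, ∑ b ∈ Finset.univ.erase a, X (swap a b) =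
      ∑ x ∈ (Finset.univ : Finset (Fin n)).offDiag, X (swap x.1 x.2) := by
    rw [Finset.sum_sigma']
    refine Finset.sum_bij' (fun x _ => (x.1, x.2)) (fun x _ => ⟨x.1, x.2⟩) ?_ ?_ ?_ ?_ ?_ <;>
      simp +contextual [eq_comm]
  rw [h, ← Finset.sum_fiberwise_of_maps_to (g := fun x : Fin n × Fin n => swap x.1 x.2)
    (t := swaps n), Finset.mul_sum]
  · refine Finset.sum_congr rfl fun τ hτ => ?_
    obtain ⟨a, b, hab, rfl⟩ := mem_swaps.1 hτ
    have hfib : (Finset.univ : Finset (Fin n)).offDiag.filter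
        (fun x => swap x.1 x.2 = swap a b) = {(a, b), (b, a)} := by
      ext ⟨x, y⟩
      simp only [Finset.mem_filter, Finset.mem_offDiag, Finset.mem_univ, true_and,
        Finset.mem_insert, Finset.mem_singleton, Prod.mk.injEq]
      constructor
      · rintro ⟨hxy, h⟩
        have h1 : swap a b x = y := by rw [← h, swap_apply_left]
        by_cases hxa : x = a
        · subst hxa
          rw [swap_apply_left] at h1
          exact Or.inl ⟨rfl, h1.symm⟩
        · by_cases hxb : x = b
          · subst hxb
            rw [swap_apply_right] at h1
            exact Or.inr ⟨rfl, h1.symm⟩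
          · rw [swap_apply_of_ne_of_ne hxa hxb] at h1
            exact absurd h1 hxy
      · rintro (⟨rfl, rfl⟩ | ⟨rfl, rfl⟩)
        · exact ⟨hab, rfl⟩
        · exact ⟨hab.symm, swap_comm _ _⟩
    rw [hfib, Finset.sum_pair (by simp [hab]), swap_comm b a, two_mul]
  · intro x hx
    exact mem_swaps.2 ⟨x.1, x.2, (Finset.mem_offDiag.1 hx).2.2, rfl⟩

lemma two_mul_sum_swaps_cycleProd {K : Type*} [Field K] [CharZero K] {u : K} (hu : u ≠ 0)
    (hs : ∀ l, 0 < l → qSinh u l ≠ 0) (σ : Perm (Fin n)) :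
    2 * ∑ τ ∈ swaps n, cycleProd (qSinh u) (τ * σ) =
      n * cycleProd (qSinh u) σ * (∑ x, qCoth u (cycleLen σ x) - qCoth u 1) := by
  apply mul_left_cancel₀ (two_ne_zero' K)
  rw [two_mul_sum_swaps, Finset.mul_sum]
  simp only [two_mul_sum_cycleProd_swap_mul hu hs, ← Finset.mul_sum, Finset.sum_sub_distrib,
    Finset.sum_add_distrib, Finset.sum_const, Finset.card_univ, Fintype.card_fin, nsmul_eq_mul]
  ring

/-- The explicit series `∑ b s * (X / n) ^ s / s!`, where `b s` is the number of factorizations of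
`σ` into `s` transpositions and a full cycle: it is
`∏ 2 sinh (l X / 2) / (n * 2 sinh (X / 2))`, with `l` running over the cycle lengths of `σ`. The
scaling of the variable by `n` makes it a multiple of the series for star factorizations. -/
noncomputable def cycleSolution (σ : Perm (Fin n)) : ℚ⟦X⟧ :=
  C (1 / (n : ℚ)) * (sinhSeries 1 ^ (numCycles σ - 1) * cycleProd sinhQuot σ)

lemma toField_cycleSolution (p : Fin n) (σ : Perm (Fin n)) :
    toField (cycleSolution σ) * qSinh (toField expHalf) 1 * n =
      cycleProd (qSinh (toField expHalf)) σ := by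
  have h1 := numCycles_pos p σ
  have hn : (n : SeriesField) ≠ 0 := by exact_mod_cast p.pos.ne'
  obtain ⟨k, hk⟩ : ∃ k, numCycles σ = k + 1 := ⟨_, (Nat.succ_pred_eq_of_pos h1).symm⟩
  rw [cycleSolution, map_mul, map_mul, map_pow, toField_C, toField_sinhSeries,
    ← toField_cycleProd_sinhQuot, hk, Nat.add_sub_cancel, Rat.cast_div, Rat.cast_one,
    Rat.cast_natCast]
  field_simp
  ring

lemma derivative_cycleSolution (p : Fin n) (σ : Perm (Fin n)) :
    derivative ℚ (cycleSolution σ) = C (1 / (n : ℚ)) * ∑ τ ∈ swaps n, cycleSolution (τ * σ) := by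
  have hu := toField_expHalf_ne_zero
  have hs := qSinh_expHalf_ne_zero
  have h1 := numCycles_pos p σ
  have hn : (n : SeriesField) ≠ 0 := by exact_mod_cast p.pos.ne'
  have hf : sinhSeries 1 ≠ 0 := sinhSeries_ne_zero one_pos
  have hC : (C (1 / (n : ℚ)) : ℚ⟦X⟧) ≠ 0 := by
    rw [Ne, map_eq_zero_iff _ C_injective]
    exact one_div_ne_zero (by exact_mod_cast p.pos.ne')
  have hne : cycleSolution σ ≠ 0 :=
    mul_ne_zero hC (mul_ne_zero (pow_ne_zero _ hf) (cycleProd_sinhQuot_ne_zero σ))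
  have hdlog : 2 * dlog (cycleSolution σ) =
      ∑ x, qCoth (toField expHalf) (cycleLen σ x) - qCoth (toField expHalf) 1 := by
    rw [cycleSolution, dlog_mul hC (mul_ne_zero (pow_ne_zero _ hf)
      (cycleProd_sinhQuot_ne_zero σ)), dlog_C, dlog_mul (pow_ne_zero _ hf)
      (cycleProd_sinhQuot_ne_zero σ), dlog_pow hf, zero_add, mul_add,
      two_mul_dlog_cycleProd_sinhQuot, mul_left_comm, two_mul_dlog_sinhSeries,
      Nat.cast_sub h1]
    push_cast
    ring
  apply toField_injective
  rw [toField_derivative hne, map_mul, toField_C, map_sum, Rat.cast_div, Rat.cast_one,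
    Rat.cast_natCast]
  have hsum : (∑ τ ∈ swaps n, toField (cycleSolution (τ * σ))) * (qSinh (toField expHalf) 1 * n) =
      ∑ τ ∈ swaps n, cycleProd (qSinh (toField expHalf)) (τ * σ) := by
    rw [Finset.sum_mul]
    refine Finset.sum_congr rfl fun τ _ => ?_
    rw [← mul_assoc, toField_cycleSolution p]
  have h2 := two_mul_sum_swaps_cycleProd hu hs σ
  rw [← hsum, ← toField_cycleSolution p σ, ← hdlog] at h2
  have hne' : 2 * qSinh (toField expHalf) 1 * n * n ≠ 0 :=
    mul_ne_zero (mul_ne_zero (mul_ne_zero two_ne_zero (hs 1 one_pos)) hn) hn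
  apply mul_left_cancel₀ hne'
  linear_combination -h2 - (2 * qSinh (toField expHalf) 1 * n *
    ∑ τ ∈ swaps n, toField (cycleSolution (τ * σ))) * mul_one_div_cancel hn

lemma isFullCycle_iff (σ : Perm (Fin n)) : IsFullCycle σ ↔ numCycles σ = 1 := by
  rw [IsFullCycle, numCycles, Multiset.card_eq_one]
  constructor
  · intro h
    exact ⟨n, h⟩
  · rintro ⟨a, ha⟩
    have := σ.partition.parts_sum
    rw [ha, Multiset.sum_singleton, Fintype.card_fin] at this
    rw [ha, this]

open Classical in
lemma constantCoeff_cycleSolution (p : Fin n) (σ : Perm (Fin n)) :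
    constantCoeff (cycleSolution σ) = if IsFullCycle σ then 1 else 0 := by
  have hn : (n : ℚ) ≠ 0 := by exact_mod_cast p.pos.ne'
  rw [cycleSolution, map_mul, map_mul, map_pow, constantCoeff_sinhSeries, constantCoeff_C]
  split_ifs with h
  · rw [(isFullCycle_iff σ).1 h, cycleProd, h, Multiset.map_singleton, Multiset.prod_singleton,
      constantCoeff_sinhQuot]
    field_simp
    simp
  · have h1 := numCycles_pos p σ
    rw [isFullCycle_iff] at h
    rw [zero_pow (by omega), zero_mul, mul_zero]

open Classical in
/-- The words of `s` transpositions that can be completed by a full cycle to a factorization of `σ`.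
The full cycle is determined by the transpositions. -/
noncomputable def swapWords (s : ℕ) (σ : Perm (Fin n)) : Finset (Fin s → Perm (Fin n)) :=
  Finset.univ.filter fun w => (∀ k, (w k).IsSwap) ∧ IsFullCycle ((List.ofFn w).prod⁻¹ * σ)

lemma mem_swapWords {s : ℕ} {σ : Perm (Fin n)} {w : Fin s → Perm (Fin n)} :
    w ∈ swapWords s σ ↔ (∀ k, (w k).IsSwap) ∧ IsFullCycle ((List.ofFn w).prod⁻¹ * σ) := by
  simp [swapWords]

open Classical in
lemma card_swapWords_zero (σ : Perm (Fin n)) :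
    (swapWords 0 σ).card = if IsFullCycle σ then 1 else 0 := by
  split_ifs with h
  · have : swapWords 0 σ = {Fin.elim0} := by
      ext w
      simp [mem_swapWords, h, Subsingleton.elim w Fin.elim0]
    rw [this, Finset.card_singleton]
  · rw [Finset.card_eq_zero, Finset.eq_empty_iff_forall_notMem]
    intro w hw
    exact h (by simpa using (mem_swapWords.1 hw).2)

lemma cons_mem_swapWords {s : ℕ} {σ τ : Perm (Fin n)} (hτ : τ.IsSwap)
    {w : Fin s → Perm (Fin n)} :
    (Fin.cons τ w : Fin (s + 1) → Perm (Fin n)) ∈ swapWords (s + 1) σ ↔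
      w ∈ swapWords s (τ * σ) := by
  have hinv : τ⁻¹ = τ := by
    obtain ⟨a, b, -, rfl⟩ := hτ
    exact swap_inv a b
  rw [mem_swapWords, mem_swapWords, List.ofFn_succ, List.prod_cons, Fin.forall_fin_succ]
  simp only [Fin.cons_zero, Fin.cons_succ, mul_inv_rev, hinv, mul_assoc, hτ, true_and]

lemma card_swapWords_succ (s : ℕ) (σ : Perm (Fin n)) :
    (swapWords (s + 1) σ).card = ∑ τ ∈ swaps n, (swapWords s (τ * σ)).card := by
  classical
  rw [Finset.card_eq_sum_card_fiberwise (f := fun w => w 0) (t := swaps n)]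
  · refine Finset.sum_congr rfl fun τ hτ => ?_
    rw [mem_swaps] at hτ
    symm
    refine Finset.card_bij (fun w _ => Fin.cons τ w) ?_ ?_ ?_
    · intro w hw
      exact Finset.mem_filter.2 ⟨(cons_mem_swapWords hτ).2 hw, rfl⟩
    · intro v _ w _ h
      exact Fin.cons_right_injective (α := fun _ => Perm (Fin n)) τ h
    · intro w hw
      obtain ⟨h1, h2⟩ := Finset.mem_filter.1 hw
      refine ⟨Fin.tail w, (cons_mem_swapWords hτ).1 ?_, ?_⟩ <;> rw [← h2, Fin.cons_self_tail]
      exact h1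
  · intro w hw
    exact Finset.mem_coe.2 (mem_swaps.2 ((mem_swapWords.1 hw).1 0))

/-- The coefficients of `cycleSolution` count factorizations into transpositions and a full cycle,
since both sides satisfy the same recurrence, which removes the first transposition. -/
theorem card_swapWords_div (p : Fin n) (s : ℕ) (σ : Perm (Fin n)) :
    ((swapWords s σ).card : ℚ) / ((n : ℚ) ^ s * s.factorial) = coeff s (cycleSolution σ) := by
  induction s generalizing σ with
  | zero =>
    rw [coeff_zero_eq_constantCoeff_apply, constantCoeff_cycleSolution p, card_swapWords_zero]
    simp
  | succ s ih =>
    have h := congrArg (coeff s) (derivative_cycleSolution p σ)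
    rw [coeff_derivative, coeff_C_mul, map_sum] at h
    have hr : ((s : ℚ) + 1) ≠ 0 := by positivity
    have hn : (n : ℚ) ≠ 0 := by exact_mod_cast p.pos.ne'
    have hf : (s.factorial : ℚ) ≠ 0 := by exact_mod_cast Nat.factorial_ne_zero s
    apply mul_right_cancel₀ hr
    rw [h, card_swapWords_succ, Nat.factorial_succ]
    simp only [← ih, ← Finset.sum_div]
    push_cast
    field_simp
    ring

/-- A group that contains a full cycle is transitive. -/
lemma generatesTransitive_of_isFullCycle {c : Perm (Fin n)} (hc : IsFullCycle c)
    {A : Set (Perm (Fin n))} (hA : c ∈ A) : GeneratesTransitive A := by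
  have hcA : c ∈ Subgroup.closure A := Subgroup.subset_closure hA
  refine ⟨fun x y => ?_⟩
  have hx : cycleClass c x = Finset.univ := by
    rw [← Finset.card_eq_iff_eq_univ, Fintype.card_fin, ← Multiset.mem_singleton, ← hc,
      parts_partition_eq_map_card]
    exact Multiset.mem_map_of_mem _ (Finset.mem_image_of_mem _ (Finset.mem_univ x))
  have hy : y ∈ cycleClass c x := by rw [hx]; exact Finset.mem_univ y
  obtain ⟨k, hk⟩ := mem_cycleClass.1 hy
  exact ⟨⟨c ^ k, zpow_mem hcA k⟩, hk⟩

lemma ncard_cycleFactorizations (s : ℕ) (σ : Perm (Fin n)) :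
    (cycleFactorizations s σ).ncard = (swapWords s σ).card := by
  rw [← Set.ncard_coe_finset]
  have hinj : Set.InjOn
      (fun w : Fin s → Perm (Fin n) => (w, (List.ofFn w).prod⁻¹ * σ)) (swapWords s σ) :=
    fun v _ w _ h => congrArg Prod.fst h
  rw [← hinj.ncard_image]
  congr 1
  ext ⟨w, c⟩
  constructor
  · rintro ⟨h1, h2, h3, -⟩
    simp only at h1 h2 h3
    have hc : (List.ofFn w).prod⁻¹ * σ = c := by rw [← h3, inv_mul_cancel_left]
    exact ⟨w, mem_swapWords.2 ⟨h1, hc ▸ h2⟩, Prod.ext rfl hc⟩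
  · rintro ⟨v, hv, h⟩
    obtain ⟨rfl, rfl⟩ := Prod.mk.inj h
    obtain ⟨h1, h2⟩ := mem_swapWords.1 hv
    exact ⟨h1, h2, mul_inv_cancel_left _ _,
      generatesTransitive_of_isFullCycle h2 (Set.mem_insert _ _)⟩

end CycleCount

/-! ### Extraction of coefficients -/

section Coefficients

/-- The sum `∑ j, (-1) ^ j * (k choose j) * (k / 2 - j) ^ N`, with `0 ^ 0 = 1`: the coefficient of
`X ^ N / N!` in `(2 sinh (X / 2)) ^ k`. -/
noncomputable def alternatingPowerSum (k N : ℕ) : ℚ :=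
  ∑ j ∈ Finset.range (k + 1), (k.choose j : ℚ) * (-1) ^ j * ((k : ℚ) / 2 - j) ^ N

lemma coeff_sinhSeries_one_pow (k N : ℕ) :
    coeff N (sinhSeries 1 ^ k) = alternatingPowerSum k N / N.factorial := by
  rw [sinhSeries, pow_one, pow_one, sub_eq_neg_add, add_pow, map_sum, alternatingPowerSum,
    Finset.sum_div]
  refine Finset.sum_congr rfl fun j hj => ?_
  have hj := Finset.mem_range.1 hj
  have h : (-expNegHalf) ^ j * expHalf ^ (k - j) * (k.choose j : ℚ⟦X⟧) =
      C ((k.choose j : ℚ) * (-1) ^ j) * rescale ((k : ℚ) / 2 - j) (exp ℚ) := by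
    have h1 : expNegHalf ^ j * expHalf ^ (k - j) = rescale ((k : ℚ) / 2 - j) (exp ℚ) := by
      rw [expNegHalf, expHalf, ← map_pow, ← map_pow, exp_pow_eq_rescale_exp,
        exp_pow_eq_rescale_exp, rescale_rescale, rescale_rescale, exp_mul_exp_eq_exp_add,
        Nat.cast_sub (by omega)]
      congr 2
      ring
    rw [neg_pow, map_mul, map_pow, map_neg, map_one, map_natCast, ← h1]
    ring
  rw [h, coeff_C_mul, coeff_rescale, coeff_exp]
  simp only [Algebra.algebraMap_self, RingHom.id_apply]
  ring

lemma alternatingPowerSum_eq_zero_of_odd {k d : ℕ} (hd : Odd d) :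
    alternatingPowerSum k (k + d) = 0 := by
  have h : alternatingPowerSum k (k + d) = -alternatingPowerSum k (k + d) := by
    conv_lhs => rw [alternatingPowerSum, ← Finset.sum_range_reflect]
    rw [alternatingPowerSum, ← Finset.sum_neg_distrib]
    refine Finset.sum_congr rfl fun j hj => ?_
    have hj := Finset.mem_range.1 hj
    have hjk : j ≤ k := by omega
    rw [show k + 1 - 1 - j = k - j by omega, Nat.choose_symm hjk, Nat.cast_sub hjk,
      show (k : ℚ) / 2 - (k - j) = -(k / 2 - j) by ring, neg_pow ((k : ℚ) / 2 - j)]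
    have h1 : (-1 : ℚ) ^ (k - j) * (-1) ^ (k + d) = -(-1) ^ j := by
      obtain ⟨i, rfl⟩ := Nat.exists_eq_add_of_le hjk
      rw [Nat.add_sub_cancel_left, pow_add, pow_add, hd.neg_one_pow]
      have : (-1 : ℚ) ^ i * (-1) ^ i = 1 := by rw [← mul_pow]; norm_num
      linear_combination -(-1 : ℚ) ^ j * this
    linear_combination ((k.choose j : ℚ) * (k / 2 - j) ^ (k + d)) * h1
  linarith

lemma X_pow_dvd_sinhSeries_one_pow (k : ℕ) : (X : ℚ⟦X⟧) ^ k ∣ sinhSeries 1 ^ k :=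
  pow_dvd_pow_of_dvd (X_dvd_iff.2 (constantCoeff_sinhSeries 1)) k

variable {n : ℕ}

lemma coeff_cycleSolution_of_lt {s : ℕ} {σ : Perm (Fin n)} (hs : s < numCycles σ - 1) :
    coeff s (cycleSolution σ) = 0 := by
  rw [cycleSolution, coeff_C_mul]
  have : (X : ℚ⟦X⟧) ^ (numCycles σ - 1) ∣
      sinhSeries 1 ^ (numCycles σ - 1) * cycleProd sinhQuot σ :=
    (X_pow_dvd_sinhSeries_one_pow _).mul_right _
  rw [X_pow_dvd_iff.1 this s hs, mul_zero]

lemma coeff_sinhSeries_one_pow_of_lt {k N : ℕ} (h : N < k) :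
    coeff N (sinhSeries 1 ^ k) = 0 :=
  X_pow_dvd_iff.1 (X_pow_dvd_sinhSeries_one_pow k) N h

/-- The relation between the two generating functions, from which the theorem follows by comparing
coefficients. -/
lemma starSolution_eq (p : Fin n) (σ : Perm (Fin n)) :
    starSolution p (Finset.univ.erase p) σ =
      C (1 / ((n - 1).factorial : ℚ)) * (sinhSeries 1 ^ (n - 1) * cycleSolution σ) := by
  have hpos := p.pos
  have h1 := numCycles_pos p σ
  have hcard : (Finset.univ.erase p).card = n - 1 := by
    rw [Finset.card_erase_of_mem (Finset.mem_univ p), Finset.card_univ, Fintype.card_fin]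
  rw [starSolution,
    if_pos (by rw [Finset.insert_erase (Finset.mem_univ p)]; exact Finset.subset_univ _), hcard,
    cycleSolution, Nat.sub_add_cancel hpos,
    show 2 * (n - 1) + numCycles σ - n = (n - 1) + (numCycles σ - 1) by omega, pow_add]
  have h2 : (1 / (n.factorial : ℚ)) = 1 / ((n - 1).factorial : ℚ) * (1 / (n : ℚ)) := by
    rw [← Nat.mul_factorial_pred hpos.ne']
    push_cast
    rw [one_div_mul_one_div, mul_comm]
  rw [h2, map_mul]
  ring

/-- The coefficients of a product `P * Q` of orders at least `k` and `l`, one of which has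
vanishing coefficients in odd distance from `k`. -/
lemma coeff_mul_eq_sum_range {P Q : ℚ⟦X⟧} {k l g : ℕ} (hP : ∀ N < k, coeff N P = 0)
    (hQ : ∀ s < l, coeff s Q = 0) (hodd : ∀ d, Odd d → coeff (k + d) P = 0) :
    coeff (k + l + 2 * g) (P * Q) =
      ∑ h ∈ Finset.range (g + 1), coeff (k + 2 * h) P * coeff (l + 2 * (g - h)) Q := by
  rw [coeff_mul]
  symm
  refine Finset.sum_of_injOn (fun h => (k + 2 * h, l + 2 * (g - h))) ?_ ?_ ?_ ?_
  · intro a _ b _ hab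
    have := congrArg Prod.fst hab
    simp only at this
    omega
  · intro h hh
    have := Finset.mem_range.1 (Finset.mem_coe.1 hh)
    rw [Finset.mem_coe, Finset.HasAntidiagonal.mem_antidiagonal]
    simp only
    omega
  · rintro ⟨N, s⟩ hNs hnot
    rw [Finset.HasAntidiagonal.mem_antidiagonal] at hNs
    simp only at hNs ⊢
    by_cases hN : N < k
    · rw [hP N hN, zero_mul]
    by_cases hs : s < l
    · rw [hQ s hs, mul_zero]
    obtain ⟨d, rfl⟩ := Nat.exists_eq_add_of_le (not_lt.1 hN)
    rcases Nat.even_or_odd d with hd | hd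
    · exfalso
      obtain ⟨h, rfl⟩ := hd
      apply hnot
      refine ⟨h, Finset.mem_coe.2 (Finset.mem_range.2 (by omega)), ?_⟩
      simp only [Prod.mk.injEq]
      omega
    · rw [hodd d hd, zero_mul]
  · intros; rfl

end Coefficients

theorem corollary7 (n : ℕ) (p : Fin n) (g : ℕ) (α : n.Partition) (m : ℕ)
    (hm : m = α.parts.card) (σ ρ : Equiv.Perm (Fin n)) (hσ : InClass α σ) (hρ : InClass α ρ) :
    (starFactorizationNumber p g σ : ℚ) =
      1 / (n.factorial : ℚ) *
        ∑ h ∈ Finset.range (g + 1),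
          (cycleFactorizationNumber (g - h) ρ : ℚ) /
              (n : ℚ) ^ ((m : ℤ) - 2 + 2 * (g : ℤ) - 2 * (h : ℤ)) *
            ((n + m - 2 + 2 * g).choose (n - 1 + 2 * h) : ℚ) *
            ∑ j ∈ Finset.range n,
              ((n - 1).choose j : ℚ) * (-1) ^ j *
                (((n : ℚ) - 1) / 2 - (j : ℚ)) ^ (n - 1 + 2 * h) := by
  have hpos := p.pos
  have hn : (n : ℚ) ≠ 0 := by exact_mod_cast hpos.ne'
  have hmσ : numCycles σ = m := by rw [hm, numCycles, hσ]
  have hmρ : numCycles ρ = m := by rw [hm, numCycles, hρ]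
  have hmpos : 0 < m := hmσ ▸ numCycles_pos p σ
  have hsol : cycleSolution σ = cycleSolution ρ := by
    rw [cycleSolution, cycleSolution, hmσ, hmρ, cycleProd, cycleProd, hσ, hρ]
  have hr : n + m - 2 + 2 * g = (n - 1) + (m - 1) + 2 * g := by omega
  have hstar := card_starWords_div_factorial (n + m - 2 + 2 * g)
    (Finset.notMem_erase p Finset.univ) σ
  have hfr : ((n + m - 2 + 2 * g).factorial : ℚ) ≠ 0 := by
    exact_mod_cast Nat.factorial_ne_zero _
  rw [starSolution_eq, coeff_C_mul, hsol, div_eq_iff hfr] at hstar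
  rw [starFactorizationNumber, hmσ, ncard_starFactorizations, hstar, hr,
    coeff_mul_eq_sum_range (fun N hN => coeff_sinhSeries_one_pow_of_lt hN)
      (fun s hs => coeff_cycleSolution_of_lt (by rwa [hmρ]))
      (fun d hd => by
        rw [coeff_sinhSeries_one_pow, alternatingPowerSum_eq_zero_of_odd hd, zero_div]),
    Finset.mul_sum, Finset.mul_sum, Finset.sum_mul]
  refine Finset.sum_congr rfl fun h hh => ?_
  have hh := Finset.mem_range.1 hh
  have hsum : ∑ j ∈ Finset.range n, ((n - 1).choose j : ℚ) * (-1) ^ j *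
      (((n : ℚ) - 1) / 2 - (j : ℚ)) ^ (n - 1 + 2 * h) =
      alternatingPowerSum (n - 1) (n - 1 + 2 * h) := by
    rw [alternatingPowerSum, Nat.sub_add_cancel hpos, Nat.cast_pred hpos]
  -- the exponent is an integer because it is `-1` for `m = 1` and `h = g`
  have hexp : (n : ℚ) ^ ((m : ℤ) - 2 + 2 * (g : ℤ) - 2 * (h : ℤ)) =
      (n : ℚ) ^ (m - 1 + 2 * (g - h)) / n := by
    rw [← zpow_natCast, div_eq_mul_inv, ← zpow_sub_one₀ hn]
    congr 1
    omega
  rw [hsum, hexp, cycleFactorizationNumber, hmρ, ncard_cycleFactorizations,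
    ← card_swapWords_div p, coeff_sinhSeries_one_pow]
  have hch : (((n - 1 + (m - 1) + 2 * g).choose (n - 1 + 2 * h) : ℕ) : ℚ) *
      (n - 1 + 2 * h).factorial * (m - 1 + 2 * (g - h)).factorial =
      (n - 1 + (m - 1) + 2 * g).factorial := by
    have := Nat.add_choose_mul_factorial_mul_factorial (n - 1 + 2 * h) (m - 1 + 2 * (g - h))
    rw [← Nat.choose_symm_add,
      show n - 1 + 2 * h + (m - 1 + 2 * (g - h)) = n - 1 + (m - 1) + 2 * g by omega] at this
    exact_mod_cast this
  have hfact : (n.factorial : ℚ) = n * (n - 1).factorial := by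
    exact_mod_cast (Nat.mul_factorial_pred hpos.ne').symm
  have h1 : ((n - 1).factorial : ℚ) ≠ 0 := by exact_mod_cast Nat.factorial_ne_zero _
  have h2 : ((n - 1 + 2 * h).factorial : ℚ) ≠ 0 := by exact_mod_cast Nat.factorial_ne_zero _
  have h3 : ((m - 1 + 2 * (g - h)).factorial : ℚ) ≠ 0 := by
    exact_mod_cast Nat.factorial_ne_zero _
  rw [← hch, hfact]
  field_simp
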